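/- Let $\mathbb O$ be the octonions, with real basis $e_0=1,e_1,\dots,e_7$ and $e_ie_j=-\delta_{ij}+\sum_k\varepsilon_{ijk}e_k$ for $i,j\ge1$, where $\varepsilon$ is totally antisymmetric and equals $1$ for $ijk=123,145,176,246,257,347,365$ (and $0$ if no permutation of $ijk$ is in this list). A differentiable function $f$ on an open set $B\subset\mathbb R^8$ with values in $\mathbb O$ is called regular if $Df=\sum_{l=0}^7e_l\,\partial_{x_l}f=0$ on $B$. For $h>0$ let $\mathbb Z^8_h=(h\mathbb Z)^8\subset\mathbb R^8$, and denote the standard basis vectors of $\mathbb R^8$ also by $e_0,\dots,e_7$. For $x\in\mathbb Z^8_h$ let $N(x)=\{x,x\pm he_0,\dots,x\pm he_7\}$. For $A\subset\mathbb Z_h^8$ let $\partial A$ be the set of all $x\in\mathbb Z^8_h$ such that $N(x)$ meets both $A$ and $\mathbb Z^8_h\setminus A$, let $A^\circ=A\setminus\partial A$, and let $V^h(A)=\sum_{x\in A}h^8$. A function $g:A\to\mathbb O$ is called discrete regular if $$D^hg(x)=\sum_{l=0}^7e_l\,\frac{g(x+he_l)-g(x-he_l)}{2h}=0\qquad\text{for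 all }x\in A^\circ .$$ Let $B\subset\mathbb R^8$ be a bounded domain with $C^3$ boundary, and let $B^h\subset\mathbb Z^8_h$ ($h>0$) be sets with $B=B^h+O(h^2)$; that is, as $h\to0^+$, the four quantities $$\max_{\alpha\in\partial B}\min_{\beta\in\partial B^h}\|\alpha-\beta\|,\quad \max_{\alpha\in\partial B^h}\min_{\beta\in\partial B}\|\alpha-\beta\|,\quad \max_{\alpha\in\overline B}\min_{\beta\in B^h}\|\alpha-\beta\|,\quad \max_{\alpha\in B^h}\min_{\beta\in\overline B}\|\alpha-\beta\|$$ tend to $0$, and $V^h(B^h\setminus B)=O(h^2)$. Say that $f$ is a scaling limit of discrete regular functions if there are discrete regular functions $f^h:B^h\to\mathbb O$ ($h>0$) with $$\lim_{h\to0^+}\ \max_{B^h\cap B}\|f-f^h\|=0 .$$ Then a function $f\in C^3(\overline B,\mathbb O)$ is regular on $B$ if and only if it is a scaling limit of discrete regular functions. Moreover, the "if" part holds for every $f\in C^3(B,\mathbb O)$: if such an $f$ is a scaling limit of discrete regular functions, then $f$ is regular on $B$. -/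

import Mathlib

open Filter Topology
open scoped ENNReal NNReal

noncomputable section

/-- Euclidean space `ℝ⁸`, with coordinates `x 0, …, x 7`. -/
abbrev R8 : Type := EuclideanSpace ℝ (Fin 8)

/-- The real vector space underlying the octonions, normed by
`‖∑ xᵢ eᵢ‖² = ∑ xᵢ²`; the product is `octMul` below. -/
abbrev Octonion : Type := EuclideanSpace ℝ (Fin 8)

/-- The basis octonion `eᵢ`; `e₀` is the unit of the octonions. -/
def octE (i : Fin 8) : Octonion := EuclideanSpace.single i 1

/-- The triples `ijk` with `e_i e_j = e_k` that define the octonion product. -/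
def octTriples : List (Fin 8 × Fin 8 × Fin 8) :=
  [(1, 2, 3), (1, 4, 5), (1, 7, 6), (2, 4, 6), (2, 5, 7), (3, 4, 7), (3, 6, 5)]

/-- The totally antisymmetric symbol `ε_{ijk}` that equals `1` on `octTriples`. -/
def octEps (i j k : Fin 8) : ℤ :=
  if (i, j, k) ∈ octTriples ∨ (j, k, i) ∈ octTriples ∨ (k, i, j) ∈ octTriples then 1
  else if (j, i, k) ∈ octTriples ∨ (i, k, j) ∈ octTriples ∨ (k, j, i) ∈ octTriples then -1
  else 0

/-- The products of basis octonions: `e_0 e_j = e_j`, `e_i e_0 = e_i`, and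
`e_i e_j = -δ_{ij} + ∑_k ε_{ijk} e_k` for `i, j ≠ 0`. -/
def octBasisMul (i j : Fin 8) : Octonion :=
  if i = 0 then octE j
  else if j = 0 then octE i
  else (if i = j then -octE 0 else 0) + ∑ k, (octEps i j k : ℝ) • octE k

/-- The (bilinear, non-associative) octonion product. -/
def octMul (x y : Octonion) : Octonion :=
  ∑ i, ∑ j, (x i * y j) • octBasisMul i j

/-- The `l`-th standard basis vector of `ℝ⁸`. -/
def stdE (l : Fin 8) : R8 := EuclideanSpace.single l 1

/-! ### Continuous theory -/

/-- The Cauchy-Fueter (Dirac) operator `D f = ∑_l e_l ∂f/∂x_l`. -/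
def diracD (f : R8 → Octonion) (x : R8) : Octonion :=
  ∑ l, octMul (octE l) (fderiv ℝ f x (stdE l))

/-- `f` is (left) octonionic regular on `B`. -/
def IsOctRegularOn (f : R8 → Octonion) (B : Set R8) : Prop :=
  ∀ x ∈ B, DifferentiableAt ℝ f x ∧ diracD f x = 0

/-- `B` has `C³` boundary: near each of its boundary points, `B` is the negativity set of a
`C³` function with non-vanishing differential at that point. -/
def HasC3Boundary (B : Set R8) : Prop :=
  ∀ p ∈ frontier B, ∃ (U : Set R8) (ρ : R8 → ℝ), IsOpen U ∧ p ∈ U ∧ ContDiffOn ℝ 3 ρ U ∧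
    fderiv ℝ ρ p ≠ 0 ∧ ∀ x ∈ U, x ∈ B ↔ ρ x < 0

/-! ### Discrete theory on the lattice `ℤ⁸_h = (hℤ)⁸`, seen inside `ℝ⁸` -/

/-- The lattice `(hℤ)⁸`. -/
def hLattice (h : ℝ) : Set R8 := {x | ∀ i, ∃ k : ℤ, x i = h * k}

/-- The neighbourhood `N(x) = {x, x ± h e_0, …, x ± h e_7}`. -/
def latticeNbhd (h : ℝ) (x : R8) : Set R8 :=
  {y | y = x ∨ ∃ l, y = x + h • stdE l ∨ y = x - h • stdE l}

/-- The (two-layered) discrete boundary of a subset `A` of the lattice. -/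
def discreteBoundary (h : ℝ) (A : Set R8) : Set R8 :=
  {x | x ∈ hLattice h ∧ (latticeNbhd h x ∩ A).Nonempty ∧
    (latticeNbhd h x ∩ (hLattice h \ A)).Nonempty}

/-- The discrete interior of a subset `A` of the lattice. -/
def discreteInterior (h : ℝ) (A : Set R8) : Set R8 := A \ discreteBoundary h A

/-- The forward difference operator in the direction `l`. -/
def forwardDiff (h : ℝ) (l : Fin 8) (f : R8 → Octonion) (x : R8) : Octonion :=
  h⁻¹ • (f (x + h • stdE l) - f x)

/-- The backward difference operator in the direction `l`. -/
def backwardDiff (h : ℝ) (l : Fin 8) (f : R8 → Octonion) (x : R8) : Octonion :=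
  h⁻¹ • (f x - f (x - h • stdE l))

/-- The discrete Cauchy-Fueter operator `D^h = ∑_l e_l ∂^h_l`, where `∂^h_l` is the mean of the
forward and the backward difference operators. -/
def discreteD (h : ℝ) (f : R8 → Octonion) (x : R8) : Octonion :=
  ∑ l, octMul (octE l) ((1 / 2 : ℝ) • (forwardDiff h l f x + backwardDiff h l f x))

/-- A function on a subset `A` of the lattice is discrete regular if `D^h f = 0` at every point of
the discrete interior of `A`, that is, wherever `D^h f` is determined by the values of `f` on `A`.
The values of `f` off `A` play no role. -/
def IsDiscreteRegular (h : ℝ) (A : Set R8) (f : R8 → Octonion) : Prop :=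
  ∀ x ∈ discreteInterior h A, discreteD h f x = 0

/-- The volume `V^h(A) = ∑_{x ∈ A} h⁸` of a subset `A` of the lattice. -/
def discreteVolume (h : ℝ) (A : Set R8) : ℝ≥0∞ := ∑' _x : A, ENNReal.ofReal (h ^ 8)

/-- `lim_{h → 0+} B^h = B`. Extended distances are used so that the distance to the
empty set is `∞`. -/
structure DiscreteConverges (B : Set R8) (Bh : ℝ → Set R8) : Prop where
  boundary_left : Tendsto
    (fun h => ⨆ a ∈ frontier B, Metric.infEDist a (discreteBoundary h (Bh h))) (𝓝[>] 0) (𝓝 0)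
  boundary_right : Tendsto
    (fun h => ⨆ a ∈ discreteBoundary h (Bh h), Metric.infEDist a (frontier B)) (𝓝[>] 0) (𝓝 0)
  closure_left : Tendsto
    (fun h => ⨆ a ∈ closure B, Metric.infEDist a (Bh h)) (𝓝[>] 0) (𝓝 0)
  closure_right : Tendsto
    (fun h => ⨆ a ∈ Bh h, Metric.infEDist a (closure B)) (𝓝[>] 0) (𝓝 0)

/-- `B = B^h + O(h²)`: the sets `B^h` converge to `B` and `V^h(B^h \ B) = O(h²)` as `h → 0+`. -/
structure DiscreteConvergesQuadratically (B : Set R8) (Bh : ℝ → Set R8) : Prop where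
  converges : DiscreteConverges B Bh
  volume_bound : ∃ C : ℝ≥0, ∀ᶠ h in 𝓝[>] (0 : ℝ),
    discreteVolume h (Bh h \ B) ≤ C * ENNReal.ofReal (h ^ 2)

/-- `f` is the scaling limit of discrete regular functions `f^h` on `B^h`:
`lim_{h → 0+} max_{B^h ∩ B} ‖f - f^h‖ = 0`. -/
def IsScalingLimitOfRegular (B : Set R8) (Bh : ℝ → Set R8) (f : R8 → Octonion) : Prop :=
  ∃ fh : ℝ → R8 → Octonion, (∀ h > 0, IsDiscreteRegular h (Bh h) (fh h)) ∧
    Tendsto (fun h => ⨆ x ∈ Bh h ∩ B, ‖f x - fh h x‖ₑ) (𝓝[>] 0) (𝓝 0)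

end

/-!
A regular function and a scaling limit of discrete regular functions are compared through the
consistency of `D^h`: for a `C¹` function `f`, `D^h f` tends to `D f` uniformly on compact sets
(`eventually_norm_discreteD_sub_diracD_le`).

Regular functions are scaling limits. A function `f` which is `C¹` up to the boundary extends to a
`C¹` function `G` on `ℝ⁸` (`exists_contDiff_extension`; straighten the boundary, reflect, glue).
By continuity `D G = 0` on the closure of `B`, so `sup ‖D^h G‖` over `B^h` tends to `0`. It remains
to solve `D^h u = D^h G` on `B^h` with `sup ‖u‖ ≤ C sup ‖D^h G‖`, and to take `f^h = G - u`.
The Clifford relations of the left multiplications by the `e_l` (`leftMul_clifford`) give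
`D^h D̄^h = ∑_l (∂^h_l)²`, a discrete Laplacian of step `2h`, so `u = D̄^h w` with a solution `w`
of the discrete Poisson equation on a large cube. The estimate of `u` is a gradient estimate for
`w`. It is proved with the maximum principle alone (`sub_le_of_abs_stepTwoLaplacian_lt`): the part
of `w` which is odd under the reflection in a hyperplane is compared with a quadratic polynomial.
Quadratic polynomials have exact discrete Laplacians, so the classical comparison argument carries
over to the lattice and no asymptotics of a discrete fundamental solution are needed.

Scaling limits are regular. The sum of `D^h (f - f^h)` over a lattice cube of fixed size inside `B`
telescopes to a sum over the boundary layers (`norm_sum_boxZ_le`), hence its mean tends to `0` with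
`sup ‖f - f^h‖`. As `D^h f^h = 0` on such cubes (`eventually_cube_subset`), the mean of `D f`
over small cubes vanishes in the limit, and so does `D f` by continuity.
-/

/-! ### Left multiplications by the basis octonions -/

/-- The coordinate `k` of the product `e_i e_j`, as an integer. -/
def octCoef (i j k : Fin 8) : ℤ :=
  if i = 0 then (if k = j then 1 else 0)
  else if j = 0 then (if k = i then 1 else 0)
  else (if i = j then (if k = 0 then -1 else 0) else 0) + octEps i j k

theorem octBasisMul_apply (i j k : Fin 8) : octBasisMul i j k = octCoef i j k := by
  unfold octBasisMul octCoef octE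
  split_ifs <;> simp_all [PiLp.single_apply, Pi.single_apply]

/-- The sign for which the conjugate of `e_l` is `conjSign l • e_l`. -/
def conjSign (l : Fin 8) : ℤ := if l = 0 then 1 else -1

/-- The Clifford relations `e_m (ē_l y) + e_l (ē_m y) = 2 δ_{lm} y` in coordinates. -/
theorem octCoef_clifford : ∀ l m j k : Fin 8,
    conjSign l * ∑ i, octCoef l j i * octCoef m i k
      + conjSign m * ∑ i, octCoef m j i * octCoef l i k
      = if l = m then (if j = k then 2 else 0) else 0 := by
  decide +kernel

theorem octMul_octE_apply (l : Fin 8) (y : Octonion) (k : Fin 8) :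
    octMul (octE l) y k = ∑ j, (octCoef l j k : ℝ) * y j := by
  have h1 : octMul (octE l) y = ∑ j, y j • octBasisMul l j := by
    unfold octMul
    rw [Finset.sum_eq_single l]
    · simp [octE]
    · intro i _ hi
      simp [octE, hi]
    · simp
  rw [h1]
  simp [octBasisMul_apply, mul_comm]

/-- Left multiplication by `e_l`, as a continuous linear map. -/
noncomputable def leftMul (l : Fin 8) : Octonion →L[ℝ] Octonion :=
  LinearMap.toContinuousLinearMap
    { toFun := octMul (octE l)
      map_add' := by
        intro x y
        ext k
        simp [octMul_octE_apply, mul_add, Finset.sum_add_distrib]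
      map_smul' := by
        intro c y
        ext k
        simp [octMul_octE_apply, Finset.mul_sum, mul_left_comm] }

theorem leftMul_apply (l : Fin 8) (y : Octonion) : leftMul l y = octMul (octE l) y := rfl

theorem leftMul_leftMul_apply (l m : Fin 8) (y : Octonion) (k : Fin 8) :
    leftMul m (leftMul l y) k = ∑ j, ((∑ i, octCoef l j i * octCoef m i k : ℤ) : ℝ) * y j := by
  rw [leftMul_apply, octMul_octE_apply]
  simp_rw [leftMul_apply, octMul_octE_apply, Finset.mul_sum]
  rw [Finset.sum_comm]
  refine Finset.sum_congr rfl fun j _ => ?_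
  push_cast
  rw [Finset.sum_mul]
  exact Finset.sum_congr rfl fun i _ => by ring

/-- The Clifford relations for left multiplications; they encode the alternativity of `𝕆`. -/
theorem leftMul_clifford (l m : Fin 8) (y : Octonion) :
    (conjSign l : ℝ) • leftMul m (leftMul l y) + (conjSign m : ℝ) • leftMul l (leftMul m y)
      = if l = m then (2 : ℝ) • y else 0 := by
  ext k
  have key : ∀ j, (conjSign l : ℝ) * ((∑ i, octCoef l j i * octCoef m i k : ℤ) : ℝ)
      + (conjSign m : ℝ) * ((∑ i, octCoef m j i * octCoef l i k : ℤ) : ℝ)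
      = if l = m then (if j = k then 2 else 0) else 0 := by
    intro j
    have := congrArg (Int.cast : ℤ → ℝ) (octCoef_clifford l m j k)
    push_cast at this ⊢
    exact this
  have h1 : ((conjSign l : ℝ) • leftMul m (leftMul l y)
      + (conjSign m : ℝ) • leftMul l (leftMul m y)) k
      = ∑ j, (if l = m then (if j = k then 2 else 0) else 0) * y j := by
    simp only [PiLp.add_apply, PiLp.smul_apply, smul_eq_mul, leftMul_leftMul_apply,
      Finset.mul_sum, ← Finset.sum_add_distrib]
    refine Finset.sum_congr rfl fun j _ => ?_
    rw [← key j]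
    ring
  rw [h1]
  split_ifs with h <;> simp

/-- Contracting a symmetric family with `e_m ē_l` only leaves the diagonal. -/
theorem sum_leftMul_leftMul_symm (T : Fin 8 → Fin 8 → Octonion) (hT : ∀ l m, T l m = T m l) :
    ∑ m, leftMul m (∑ l, (conjSign l : ℝ) • leftMul l (T m l)) = ∑ l, T l l := by
  have e : ∑ m, leftMul m (∑ l, (conjSign l : ℝ) • leftMul l (T m l))
      = ∑ m, ∑ l, (conjSign l : ℝ) • leftMul m (leftMul l (T m l)) := by
    simp
  have e' : ∑ m, ∑ l, (conjSign l : ℝ) • leftMul m (leftMul l (T m l))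
      = ∑ m, ∑ l, (conjSign m : ℝ) • leftMul l (leftMul m (T m l)) := by
    rw [Finset.sum_comm]
    exact Finset.sum_congr rfl fun m _ => Finset.sum_congr rfl fun l _ => by rw [hT]
  have h2 : (2 : ℝ) • ∑ m, leftMul m (∑ l, (conjSign l : ℝ) • leftMul l (T m l))
      = (2 : ℝ) • ∑ l, T l l := by
    rw [two_smul]
    nth_rw 2 [e]
    rw [e, e', ← e', e']
    nth_rw 1 [← e']
    rw [← Finset.sum_add_distrib]
    simp_rw [← Finset.sum_add_distrib, leftMul_clifford]
    simp [Finset.smul_sum]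
  exact smul_right_injective _ (two_ne_zero) h2

/-- A common bound for the norms of the left multiplications. -/
noncomputable def leftMulBound : ℝ := ∑ l, ‖leftMul l‖

theorem leftMulBound_nonneg : 0 ≤ leftMulBound := Finset.sum_nonneg fun _ _ => norm_nonneg _

theorem norm_leftMul_le (l : Fin 8) (y : Octonion) : ‖leftMul l y‖ ≤ leftMulBound * ‖y‖ :=
  (leftMul l).le_of_opNorm_le
    (Finset.single_le_sum (f := fun l => ‖leftMul l‖) (fun _ _ => norm_nonneg _)
      (Finset.mem_univ l)) y

theorem diracD_eq (f : R8 → Octonion) (x : R8) :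
    diracD f x = ∑ l, leftMul l (fderiv ℝ f x (stdE l)) := rfl

theorem discreteD_eq (h : ℝ) (f : R8 → Octonion) (x : R8) :
    discreteD h f x
      = (2 * h)⁻¹ • ∑ l, leftMul l (f (x + h • stdE l) - f (x - h • stdE l)) := by
  unfold discreteD forwardDiff backwardDiff
  rw [Finset.smul_sum]
  refine Finset.sum_congr rfl fun l _ => ?_
  rw [← leftMul_apply, ← map_smul]
  congr 1
  rw [← smul_add, smul_smul, mul_inv, one_div]
  congr 1
  abel

theorem discreteD_sub (h : ℝ) (f g : R8 → Octonion) (x : R8) :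
    discreteD h (fun y => f y - g y) x = discreteD h f x - discreteD h g x := by
  simp only [discreteD_eq, ← smul_sub, ← Finset.sum_sub_distrib, ← map_sub]
  congr 1
  exact Finset.sum_congr rfl fun l _ => by congr 1; abel

/-! ### Discrete potential theory on `ℤ⁸` -/

/-- The `l`-th unit vector of the index lattice `ℤ⁸`. -/
def unitZ (l : Fin 8) : Fin 8 → ℤ := Pi.single l 1

theorem unitZ_self (l : Fin 8) : unitZ l l = 1 := by simp [unitZ]

theorem unitZ_of_ne {l i : Fin 8} (h : i ≠ l) : unitZ l i = 0 := by simp [unitZ, h]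

/-- The Laplacian of step two on `ℤ⁸`, without normalisation: the square of the central
differences. -/
def stepTwoLaplacian {V : Type*} [AddCommGroup V] [Module ℝ V] (w : (Fin 8 → ℤ) → V)
    (k : Fin 8 → ℤ) : V :=
  ∑ l, (w (k + unitZ l + unitZ l) - (2 : ℝ) • w k + w (k - unitZ l - unitZ l))

/-- A maximum principle. If `φ` is strictly subharmonic wherever it is positive on the finite set
`S`, and is nonpositive at those neighbours of its positivity points which lie outside `S`, then
`φ ≤ 0` on `S`. -/
theorem nonpos_of_stepTwoLaplacian_pos (S : Finset (Fin 8 → ℤ)) (φ : (Fin 8 → ℤ) → ℝ)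
    (hL : ∀ k ∈ S, 0 < φ k → 0 < stepTwoLaplacian φ k)
    (hp : ∀ k ∈ S, 0 < φ k → ∀ l, k + unitZ l + unitZ l ∈ S ∨ φ (k + unitZ l + unitZ l) ≤ 0)
    (hm : ∀ k ∈ S, 0 < φ k → ∀ l, k - unitZ l - unitZ l ∈ S ∨ φ (k - unitZ l - unitZ l) ≤ 0) :
    ∀ k ∈ S, φ k ≤ 0 := by
  intro k hk
  by_contra! hpos
  obtain ⟨m, hmS, hmax⟩ := S.exists_max_image φ ⟨k, hk⟩
  have hφm : 0 < φ m := hpos.trans_le (hmax k hk)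
  have h1 : ∀ l, φ (m + unitZ l + unitZ l) ≤ φ m := fun l =>
    (hp m hmS hφm l).elim (hmax _) fun h => h.trans hφm.le
  have h2 : ∀ l, φ (m - unitZ l - unitZ l) ≤ φ m := fun l =>
    (hm m hmS hφm l).elim (hmax _) fun h => h.trans hφm.le
  refine absurd (hL m hmS hφm) (not_lt.2 (Finset.sum_nonpos fun l _ => ?_))
  have := h1 l
  have := h2 l
  simp only [smul_eq_mul]
  linarith

/-- The cube `{k : |k_i| ≤ N}` in `ℤ⁸`. -/
noncomputable def cubeZ (N : ℕ) : Finset (Fin 8 → ℤ) := Fintype.piFinset fun _ => Finset.Icc (-(N : ℤ)) N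

theorem mem_cubeZ {N : ℕ} {k : Fin 8 → ℤ} : k ∈ cubeZ N ↔ ∀ i, |k i| ≤ N := by
  simp [cubeZ, abs_le]

theorem stepTwoLaplacian_sub (v w : (Fin 8 → ℤ) → ℝ) (k : Fin 8 → ℤ) :
    stepTwoLaplacian (fun k => v k - w k) k = stepTwoLaplacian v k - stepTwoLaplacian w k := by
  simp only [stepTwoLaplacian, ← Finset.sum_sub_distrib, smul_eq_mul]
  exact Finset.sum_congr rfl fun l _ => by ring

/-- The discrete Laplacian of a polynomial of degree two without mixed terms. -/
theorem stepTwoLaplacian_quadratic (a b : Fin 8 → ℝ) (c : ℝ) (k : Fin 8 → ℤ) :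
    stepTwoLaplacian (fun k => ∑ i, (a i * (k i : ℝ) ^ 2 + b i * k i) + c) k = 8 * ∑ i, a i := by
  unfold stepTwoLaplacian
  rw [Finset.mul_sum]
  refine Finset.sum_congr rfl fun l _ => ?_
  have h : ∀ i, (a i * (((k + unitZ l + unitZ l) i : ℤ) : ℝ) ^ 2
        + b i * ((k + unitZ l + unitZ l) i : ℤ)) - 2 * (a i * (k i : ℝ) ^ 2 + b i * k i)
      + (a i * (((k - unitZ l - unitZ l) i : ℤ) : ℝ) ^ 2
        + b i * ((k - unitZ l - unitZ l) i : ℤ)) = if i = l then 8 * a l else 0 := by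
    intro i
    by_cases hi : i = l
    · subst hi
      simp only [Pi.add_apply, Pi.sub_apply, unitZ_self, if_true]
      push_cast
      ring
    · simp only [Pi.add_apply, Pi.sub_apply, unitZ_of_ne hi, if_neg hi]
      push_cast
      ring
  have h' := Finset.sum_congr rfl fun i (_ : i ∈ Finset.univ) => h i
  rw [Finset.sum_ite_eq' Finset.univ l] at h'
  simp only [Finset.mem_univ, if_true, Finset.sum_add_distrib, Finset.sum_sub_distrib] at h'
  simp only [smul_eq_mul, Finset.sum_add_distrib]
  rw [← h']
  simp only [← Finset.mul_sum, Finset.sum_add_distrib]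
  ring

/-- The a priori bound for the Dirichlet problem on a cube, by comparison with the barrier
`ε ((N + 2)² - k₀²)`. -/
theorem le_of_stepTwoLaplacian_gt {N : ℕ} {w : (Fin 8 → ℤ) → ℝ} {ε : ℝ} (hε : 0 < ε)
    (hw : ∀ k, k ∉ cubeZ N → w k = 0) (hL : ∀ k ∈ cubeZ N, -ε < stepTwoLaplacian w k)
    (k : Fin 8 → ℤ) : w k ≤ ε * (N + 2) ^ 2 := by
  by_cases hk : k ∈ cubeZ N
  swap
  · rw [hw k hk]; positivity
  let ψ : (Fin 8 → ℤ) → ℝ := fun k =>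
    ∑ i, ((if i = 0 then -ε else 0) * (k i : ℝ) ^ 2 + 0 * k i) + ε * (N + 2) ^ 2
  have hψ : ∀ k, ψ k = ε * ((N + 2) ^ 2 - (k 0 : ℝ) ^ 2) := by
    intro k
    simp only [ψ, zero_mul, add_zero, ite_mul, Finset.sum_ite_eq', Finset.mem_univ, if_true]
    ring
  have hLψ : ∀ k, stepTwoLaplacian ψ k = -(8 * ε) := by
    intro k
    simp only [ψ]
    rw [stepTwoLaplacian_quadratic (fun i => if i = 0 then -ε else 0) (fun _ => 0)]
    simp
  have hψ0 : ∀ k : Fin 8 → ℤ, |k 0| ≤ N + 2 → 0 ≤ ψ k := by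
    intro k hk
    rw [hψ]
    refine mul_nonneg hε.le ?_
    have h1 : |(k 0 : ℝ)| ≤ N + 2 := by exact_mod_cast hk
    have := sq_le_sq' (by linarith [neg_abs_le (k 0 : ℝ)]) ((le_abs_self _).trans h1)
    linarith
  have hu : ∀ l : Fin 8, 0 ≤ unitZ l 0 ∧ unitZ l 0 ≤ 1 := by
    intro l
    by_cases h : (0 : Fin 8) = l
    · subst h; simp [unitZ_self]
    · simp [unitZ_of_ne h]
  have h := nonpos_of_stepTwoLaplacian_pos (cubeZ N) (fun k => w k - ψ k) ?_ ?_ ?_ k hk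
  · have h2 : ψ k ≤ ε * (N + 2) ^ 2 := by
      rw [hψ]
      exact mul_le_mul_of_nonneg_left (by linarith [sq_nonneg (k 0 : ℝ)]) hε.le
    linarith
  · intro k hk _
    rw [stepTwoLaplacian_sub, hLψ]
    linarith [hL k hk]
  · intro k hk _ l
    by_cases hm : k + unitZ l + unitZ l ∈ cubeZ N
    · exact Or.inl hm
    · refine Or.inr ?_
      rw [hw _ hm, zero_sub, neg_nonpos]
      apply hψ0
      have := mem_cubeZ.1 hk 0
      have := hu l
      simp only [Pi.add_apply]
      rw [abs_le] at *
      constructor <;> linarith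
  · intro k hk _ l
    by_cases hm : k - unitZ l - unitZ l ∈ cubeZ N
    · exact Or.inl hm
    · refine Or.inr ?_
      rw [hw _ hm, zero_sub, neg_nonpos]
      apply hψ0
      have := mem_cubeZ.1 hk 0
      have := hu l
      simp only [Pi.sub_apply]
      rw [abs_le] at *
      constructor <;> linarith

theorem stepTwoLaplacian_neg (w : (Fin 8 → ℤ) → ℝ) (k : Fin 8 → ℤ) :
    stepTwoLaplacian (fun k => -w k) k = -stepTwoLaplacian w k := by
  simp only [stepTwoLaplacian, ← Finset.sum_neg_distrib, smul_eq_mul]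
  exact Finset.sum_congr rfl fun l _ => by ring

theorem abs_le_of_abs_stepTwoLaplacian_lt {N : ℕ} {w : (Fin 8 → ℤ) → ℝ} {ε : ℝ} (hε : 0 < ε)
    (hw : ∀ k, k ∉ cubeZ N → w k = 0) (hL : ∀ k ∈ cubeZ N, |stepTwoLaplacian w k| < ε)
    (k : Fin 8 → ℤ) : |w k| ≤ ε * (N + 2) ^ 2 := by
  refine abs_le'.2 ⟨le_of_stepTwoLaplacian_gt hε hw (fun k hk => (abs_lt.1 (hL k hk)).1) k, ?_⟩
  refine le_of_stepTwoLaplacian_gt (w := fun k => -w k) hε (fun k hk => by simp [hw k hk])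
    (fun k hk => ?_) k
  rw [stepTwoLaplacian_neg]
  linarith [(abs_lt.1 (hL k hk)).2]

/-- The Dirichlet problem on a cube is solvable: uniqueness follows from the a priori bound, and
implies existence by finiteness of the dimension. -/
theorem exists_stepTwoLaplacian_eq (N : ℕ) (F : (Fin 8 → ℤ) → ℝ) :
    ∃ w : (Fin 8 → ℤ) → ℝ, (∀ k, k ∉ cubeZ N → w k = 0) ∧
      ∀ k ∈ cubeZ N, stepTwoLaplacian w k = F k := by
  classical
  let ext : (cubeZ N → ℝ) → (Fin 8 → ℤ) → ℝ := fun w k => if h : k ∈ cubeZ N then w ⟨k, h⟩ else 0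
  have ext_add : ∀ v w k, ext (v + w) k = ext v k + ext w k := by
    intro v w k
    by_cases h : k ∈ cubeZ N <;> simp [ext, h]
  have ext_smul : ∀ (c : ℝ) w k, ext (c • w) k = c * ext w k := by
    intro c w k
    by_cases h : k ∈ cubeZ N <;> simp [ext, h]
  let T : (cubeZ N → ℝ) →ₗ[ℝ] (cubeZ N → ℝ) :=
    { toFun := fun w k => stepTwoLaplacian (ext w) k
      map_add' := by
        intro v w
        funext k
        simp only [stepTwoLaplacian, ext_add, Pi.add_apply, ← Finset.sum_add_distrib, smul_eq_mul]
        exact Finset.sum_congr rfl fun l _ => by ring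
      map_smul' := by
        intro c w
        funext k
        simp only [stepTwoLaplacian, ext_smul, Pi.smul_apply, Finset.mul_sum, smul_eq_mul,
          RingHom.id_apply]
        exact Finset.sum_congr rfl fun l _ => by ring }
  have hext0 : ∀ w k, k ∉ cubeZ N → ext w k = 0 := fun w k hk => by simp [ext, hk]
  have hinj : Function.Injective T := by
    rw [← LinearMap.ker_eq_bot, LinearMap.ker_eq_bot']
    intro w hw
    funext k
    have hb : ∀ ε : ℝ, 0 < ε → |ext w k| ≤ ε * (N + 2) ^ 2 := fun ε hε =>
      abs_le_of_abs_stepTwoLaplacian_lt hε (hext0 w) (fun k hk => by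
        have : stepTwoLaplacian (ext w) k = 0 := congrFun hw ⟨k, hk⟩
        rwa [this, abs_zero]) k
    have h0 : |ext w k| ≤ 0 := by
      refine le_of_forall_pos_le_add fun δ hδ => ?_
      have := hb (δ / (N + 2) ^ 2) (by positivity)
      rwa [div_mul_cancel₀ _ (by positivity), ← zero_add δ] at this
    have h1 : ext w k = w k := by simp [ext]
    rw [← h1]
    exact abs_nonpos_iff.1 h0
  obtain ⟨w, hw⟩ := LinearMap.injective_iff_surjective.1 hinj fun k => F k
  exact ⟨ext w, hext0 w, fun k hk => congrFun hw ⟨k, hk⟩⟩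

/-- The reflection of `ℤ⁸` in the hyperplane `k_l = 0`. -/
def reflectZ (l : Fin 8) (k : Fin 8 → ℤ) : Fin 8 → ℤ := Function.update k l (-k l)

theorem reflectZ_self (l : Fin 8) (k : Fin 8 → ℤ) : reflectZ l k l = -k l := by simp [reflectZ]

theorem reflectZ_of_ne {l i : Fin 8} (h : i ≠ l) (k : Fin 8 → ℤ) : reflectZ l k i = k i := by
  simp [reflectZ, h]

theorem reflectZ_add (l : Fin 8) (j k : Fin 8 → ℤ) :
    reflectZ l (j + k) = reflectZ l j + reflectZ l k := by
  funext i
  by_cases h : i = l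
  · subst h; simp only [reflectZ_self, Pi.add_apply]; ring
  · simp only [reflectZ_of_ne h, Pi.add_apply]

theorem reflectZ_sub (l : Fin 8) (j k : Fin 8 → ℤ) :
    reflectZ l (j - k) = reflectZ l j - reflectZ l k := by
  funext i
  by_cases h : i = l
  · subst h; simp only [reflectZ_self, Pi.sub_apply]; ring
  · simp only [reflectZ_of_ne h, Pi.sub_apply]

theorem reflectZ_unitZ (l m : Fin 8) :
    reflectZ l (unitZ m) = if m = l then -unitZ l else unitZ m := by
  funext i
  by_cases h : i = l
  · subst h
    rw [reflectZ_self]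
    split_ifs with hm
    · subst hm; rfl
    · rw [unitZ_of_ne (Ne.symm hm)]; rfl
  · rw [reflectZ_of_ne h]
    split_ifs with hm
    · subst hm; simp [unitZ_of_ne h]
    · rfl

theorem stepTwoLaplacian_comp_reflectZ (l : Fin 8) (w : (Fin 8 → ℤ) → ℝ) (k₀ k : Fin 8 → ℤ) :
    stepTwoLaplacian (fun k => w (k₀ + reflectZ l k)) k
      = stepTwoLaplacian w (k₀ + reflectZ l k) := by
  unfold stepTwoLaplacian
  refine Finset.sum_congr rfl fun m _ => ?_
  simp only [reflectZ_add, reflectZ_sub, reflectZ_unitZ]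
  split_ifs with h
  · subst h
    simp only [smul_eq_mul, ← sub_eq_add_neg, sub_neg_eq_add, ← add_sub_assoc, ← add_assoc]
    ring
  · simp only [← add_sub_assoc, ← add_assoc]

theorem stepTwoLaplacian_comp_add (w : (Fin 8 → ℤ) → ℝ) (k₀ k : Fin 8 → ℤ) :
    stepTwoLaplacian (fun k => w (k₀ + k)) k = stepTwoLaplacian w (k₀ + k) := by
  unfold stepTwoLaplacian
  simp only [← add_sub_assoc, ← add_assoc]

/-- A function which is odd under the reflection `k_l ↦ -k_l` is small next to the mirror. The
comparison function is `A (∑ k_i² + 16 k_l (d + 2 - k_l) + 15)`: it is superharmonic, it is at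
least `A d²` on the rest of the boundary of the half cube, and the constant `15` makes
it positive on average at the two points next to the mirror. -/
theorem apply_unitZ_le_of_odd {d : ℕ} {l : Fin 8} {v : (Fin 8 → ℤ) → ℝ} {A : ℝ} (hA : 0 ≤ A)
    (hd : 1 ≤ d)
    (hodd : ∀ k, v (reflectZ l k) = -v k) (hv : ∀ k, v k ≤ A * d ^ 2)
    (hL : ∀ k ∈ cubeZ d, -(64 * A) < stepTwoLaplacian v k) :
    v (unitZ l) ≤ 16 * A * (d + 2) := by
  let ψ : (Fin 8 → ℤ) → ℝ := fun k =>
    ∑ i, ((A * (1 - if i = l then 16 else 0)) * (k i : ℝ) ^ 2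
      + (if i = l then 16 * A * (d + 2) else 0) * k i) + 15 * A
  have hψ : ∀ k, ψ k = A * (∑ i, (k i : ℝ) ^ 2 + 16 * (k l * (d + 2 - k l)) + 15) := by
    intro k
    simp only [ψ, Finset.sum_add_distrib, mul_sub, sub_mul, Finset.sum_sub_distrib, ite_mul,
      mul_ite, zero_mul, mul_zero, Finset.sum_ite_eq', Finset.mem_univ, if_true, mul_one,
      ← Finset.mul_sum]
    ring
  have hLψ : ∀ k, stepTwoLaplacian ψ k = -(64 * A) := by
    intro k
    simp only [ψ]
    rw [stepTwoLaplacian_quadratic (fun i => A * (1 - if i = l then 16 else 0))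
      (fun i => if i = l then 16 * A * (d + 2) else 0)]
    simp only [← Finset.mul_sum, Finset.sum_sub_distrib, Finset.sum_ite_eq', Finset.mem_univ,
      if_true, Finset.sum_const, Finset.card_univ, Fintype.card_fin]
    norm_num
    ring
  have hψsq : ∀ (k : Fin 8 → ℤ) i, 0 ≤ k l → k l ≤ d + 2 → A * (k i : ℝ) ^ 2 ≤ ψ k := by
    intro k i h0 h1
    rw [hψ]
    refine mul_le_mul_of_nonneg_left ?_ hA
    have h0' : (0 : ℝ) ≤ k l := by exact_mod_cast h0
    have h1' : (k l : ℝ) ≤ d + 2 := by exact_mod_cast h1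
    have h2 := mul_nonneg h0' (sub_nonneg.2 h1')
    have h3 := Finset.single_le_sum (f := fun i => (k i : ℝ) ^ 2) (fun _ _ => sq_nonneg _)
      (Finset.mem_univ i)
    linarith
  -- Comparison holds on the part of the boundary away from the mirror.
  have hout : ∀ (k : Fin 8 → ℤ), 0 ≤ k l → k l ≤ d + 2 → k ∉ cubeZ d → v k - ψ k ≤ 0 := by
    intro k h0 h1 hk
    rw [mem_cubeZ] at hk
    push Not at hk
    obtain ⟨i, hi⟩ := hk
    have h2 : (d : ℝ) ^ 2 ≤ (k i : ℝ) ^ 2 := by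
      rw [← sq_abs (k i : ℝ)]
      have : (d : ℝ) ≤ |(k i : ℝ)| := by exact_mod_cast hi.le
      exact pow_le_pow_left₀ (by positivity) this 2
    have := mul_le_mul_of_nonneg_left h2 hA
    linarith [hψsq k i h0 h1, hv k]
  have hmirror : ∀ k, k l = 0 → v k = 0 := by
    intro k hk
    have : reflectZ l k = k := by
      funext i
      by_cases h : i = l
      · subst h; rw [reflectZ_self, hk]; rfl
      · rw [reflectZ_of_ne h]
    have h := hodd k
    rw [this] at h
    linarith
  have hmem : unitZ l ∈ (cubeZ d).filter fun k => 1 ≤ k l := by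
    rw [Finset.mem_filter, mem_cubeZ]
    refine ⟨fun i => ?_, by rw [unitZ_self]⟩
    by_cases h : i = l
    · subst h; rw [unitZ_self]; simpa using hd
    · rw [unitZ_of_ne h]; simp
  have key := nonpos_of_stepTwoLaplacian_pos ((cubeZ d).filter fun k => 1 ≤ k l)
    (fun k => v k - ψ k) ?_ ?_ ?_ _ hmem
  · have h1 : ψ (unitZ l) = 16 * A * (d + 2) := by
      rw [hψ]
      have : ∑ i, ((unitZ l i : ℤ) : ℝ) ^ 2 = 1 := by
        rw [Finset.sum_eq_single l]
        · simp [unitZ_self]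
        · intro i _ hi; simp [unitZ_of_ne hi]
        · simp
      rw [this, unitZ_self]
      push_cast
      ring
    linarith
  · intro k hk _
    rw [stepTwoLaplacian_sub, hLψ]
    linarith [hL k (Finset.mem_filter.1 hk).1]
  · intro k hk _ m
    rw [Finset.mem_filter] at hk
    have hkl : k l ≤ d := (le_abs_self _).trans (mem_cubeZ.1 hk.1 l)
    have hu : 0 ≤ unitZ m l ∧ unitZ m l ≤ 1 := by
      by_cases h : l = m
      · subst h; simp [unitZ_self]
      · simp [unitZ_of_ne h]
    have e : (k + unitZ m + unitZ m) l = k l + unitZ m l + unitZ m l := rfl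
    by_cases hm : k + unitZ m + unitZ m ∈ cubeZ d
    · exact Or.inl (Finset.mem_filter.2 ⟨hm, by rw [e]; omega⟩)
    · exact Or.inr (hout _ (by rw [e]; omega) (by rw [e]; omega) hm)
  · intro k hk hpos m
    rw [Finset.mem_filter] at hk
    have hkl : k l ≤ d := (le_abs_self _).trans (mem_cubeZ.1 hk.1 l)
    have e : (k - unitZ m - unitZ m) l = k l - unitZ m l - unitZ m l := rfl
    by_cases hml : l = m
    · subst hml
      rw [unitZ_self] at e
      by_cases h1 : k l = 1
      · right
        -- Here the neighbour is the mirror image of `k`, so `v` changes sign.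
        have hr : k - unitZ l - unitZ l = reflectZ l k := by
          funext i
          by_cases h : i = l
          · subst h; rw [e, reflectZ_self]; omega
          · rw [reflectZ_of_ne h]; simp [unitZ_of_ne h]
        have hs : ψ (reflectZ l k) + ψ k = A * (2 * (∑ i, (k i : ℝ) ^ 2 - 1)) := by
          have : ∑ i, ((reflectZ l k i : ℤ) : ℝ) ^ 2 = ∑ i, (k i : ℝ) ^ 2 := by
            refine Finset.sum_congr rfl fun i _ => ?_
            by_cases h : i = l
            · subst h; rw [reflectZ_self]; push_cast; ring
            · rw [reflectZ_of_ne h]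
          rw [hψ, hψ, this, reflectZ_self, h1]
          push_cast
          ring
        have h3 := Finset.single_le_sum (f := fun i => (k i : ℝ) ^ 2) (fun _ _ => sq_nonneg _)
          (Finset.mem_univ l)
        simp only [h1] at h3
        have h4 : 0 ≤ A * (2 * (∑ i, (k i : ℝ) ^ 2 - 1)) :=
          mul_nonneg hA (by norm_num at h3 ⊢; linarith)
        rw [hr, hodd]
        linarith
      · by_cases h2 : k l = 2
        · right
          have h3 : (k - unitZ l - unitZ l) l = 0 := by rw [e]; omega
          have h4 := hψsq (k - unitZ l - unitZ l) l h3.ge (by rw [h3]; positivity)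
          rw [hmirror _ h3]
          have : 0 ≤ A * (((k - unitZ l - unitZ l) l : ℤ) : ℝ) ^ 2 := by positivity
          linarith
        · by_cases hm : k - unitZ l - unitZ l ∈ cubeZ d
          · exact Or.inl (Finset.mem_filter.2 ⟨hm, by rw [e]; omega⟩)
          · exact Or.inr (hout _ (by rw [e]; omega) (by rw [e]; omega) hm)
    · rw [unitZ_of_ne hml] at e
      by_cases hm : k - unitZ m - unitZ m ∈ cubeZ d
      · exact Or.inl (Finset.mem_filter.2 ⟨hm, by rw [e]; omega⟩)
      · exact Or.inr (hout _ (by rw [e]; omega) (by rw [e]; omega) hm)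

/-- The interior gradient estimate for the discrete Poisson equation, one-sided version: it
follows from `apply_unitZ_le_of_odd` for the odd part of `w` under the reflection in the hyperplane
through `k₀` orthogonal to the direction `l`. -/
theorem sub_le_of_abs_stepTwoLaplacian_lt {d : ℕ} (hd : 1 ≤ d) {w : (Fin 8 → ℤ) → ℝ} {ε : ℝ}
    (hε : 0 < ε) (hw : ∀ k, k ∉ cubeZ (2 * d) → w k = 0)
    (hL : ∀ k ∈ cubeZ (2 * d), |stepTwoLaplacian w k| < ε) {k₀ : Fin 8 → ℤ} (hk₀ : k₀ ∈ cubeZ d)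
    (l : Fin 8) : w (k₀ + unitZ l) - w (k₀ - unitZ l) ≤ 1536 * d * ε := by
  have hM := abs_le_of_abs_stepTwoLaplacian_lt hε hw hL
  have hd1 : (1 : ℝ) ≤ d := by exact_mod_cast hd
  have hbound : ∀ k, |w k| ≤ 16 * ε * d ^ 2 := by
    intro k
    refine (hM k).trans ?_
    push_cast
    rw [mul_comm 16 ε, mul_assoc]
    refine mul_le_mul_of_nonneg_left ?_ hε.le
    nlinarith
  have hmem : ∀ k ∈ cubeZ d, k₀ + k ∈ cubeZ (2 * d) := by
    intro k hk
    rw [mem_cubeZ] at *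
    intro i
    refine (abs_add_le _ _).trans ?_
    have := hk i
    have := hk₀ i
    push_cast
    linarith
  have hr : ∀ k ∈ cubeZ d, reflectZ l k ∈ cubeZ d := by
    intro k hk
    rw [mem_cubeZ] at *
    intro i
    by_cases h : i = l
    · subst h; rw [reflectZ_self, abs_neg]; exact hk i
    · rw [reflectZ_of_ne h]; exact hk i
  have h := apply_unitZ_le_of_odd (l := l) (A := 32 * ε) (d := d)
    (v := fun k => w (k₀ + k) - w (k₀ + reflectZ l k)) (by positivity) hd ?_ ?_ ?_
  · rw [reflectZ_unitZ, if_pos rfl, ← sub_eq_add_neg] at h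
    refine h.trans ?_
    nlinarith
  · intro k
    have : reflectZ l (reflectZ l k) = k := by
      funext i
      by_cases h : i = l
      · subst h; rw [reflectZ_self, reflectZ_self, neg_neg]
      · rw [reflectZ_of_ne h, reflectZ_of_ne h]
    simp only [this, neg_sub]
  · intro k
    have h1 := (abs_le.1 (hbound (k₀ + k))).2
    have h2 := (abs_le.1 (hbound (k₀ + reflectZ l k))).1
    linarith
  · intro k hk
    rw [stepTwoLaplacian_sub, stepTwoLaplacian_comp_add, stepTwoLaplacian_comp_reflectZ]
    have h1 := (abs_lt.1 (hL _ (hmem k hk))).1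
    have h2 := (abs_lt.1 (hL _ (hmem _ (hr k hk)))).2
    linarith

theorem abs_sub_le_of_abs_stepTwoLaplacian_lt {d : ℕ} (hd : 1 ≤ d) {w : (Fin 8 → ℤ) → ℝ} {ε : ℝ}
    (hε : 0 < ε) (hw : ∀ k, k ∉ cubeZ (2 * d) → w k = 0)
    (hL : ∀ k ∈ cubeZ (2 * d), |stepTwoLaplacian w k| < ε) {k₀ : Fin 8 → ℤ} (hk₀ : k₀ ∈ cubeZ d)
    (l : Fin 8) : |w (k₀ + unitZ l) - w (k₀ - unitZ l)| ≤ 1536 * d * ε := by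
  refine abs_le'.2 ⟨sub_le_of_abs_stepTwoLaplacian_lt hd hε hw hL hk₀ l, ?_⟩
  have h := sub_le_of_abs_stepTwoLaplacian_lt (w := fun k => -w k) hd hε
    (fun k hk => by simp [hw k hk])
    (fun k hk => by rw [stepTwoLaplacian_neg, abs_neg]; exact hL k hk) hk₀ l
  linarith

/-- The inhomogeneous discrete Cauchy-Fueter equation on a cube is solvable with a bound which is
linear in the size of the cube: the solution is `D̄ w`, where the coordinates of `w` solve
discrete Poisson equations. -/
theorem exists_discrete_cauchyFueter_solution {d : ℕ} (hd : 1 ≤ d) (F : (Fin 8 → ℤ) → Octonion) :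
    ∃ U : (Fin 8 → ℤ) → Octonion,
      (∀ k ∈ cubeZ d, ∑ m, leftMul m (U (k + unitZ m) - U (k - unitZ m)) = F k) ∧
      ∀ ε > 0, (∀ k, ‖F k‖ < ε) → ∀ k ∈ cubeZ d, ‖U k‖ ≤ 64 * leftMulBound * (1536 * d * ε) := by
  choose w hw0 hwL using fun i : Fin 8 => exists_stepTwoLaplacian_eq (2 * d) fun k => F k i
  let W : (Fin 8 → ℤ) → Octonion := fun k => WithLp.toLp 2 fun i => w i k
  have hWL : ∀ k ∈ cubeZ (2 * d), stepTwoLaplacian W k = F k := by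
    intro k hk
    ext i
    rw [← hwL i k hk]
    simp [stepTwoLaplacian, W]
  have hgrad : ∀ ε > 0, (∀ k, ‖F k‖ < ε) → ∀ k ∈ cubeZ d, ∀ l,
      ‖W (k + unitZ l) - W (k - unitZ l)‖ ≤ 8 * (1536 * d * ε) := by
    intro ε hε hF k hk l
    have h1 : ‖W (k + unitZ l) - W (k - unitZ l)‖
        ≤ ∑ i, ‖(W (k + unitZ l) - W (k - unitZ l)) i‖ := by
      have e := (EuclideanSpace.basisFun (Fin 8) ℝ).sum_repr (W (k + unitZ l) - W (k - unitZ l))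
      conv_lhs => rw [← e]
      refine (norm_sum_le _ _).trans (Finset.sum_le_sum fun i _ => ?_)
      rw [norm_smul, OrthonormalBasis.norm_eq_one, mul_one]
      rfl
    refine h1.trans ?_
    have h2 : ∀ i, ‖(W (k + unitZ l) - W (k - unitZ l)) i‖ ≤ 1536 * d * ε := fun i =>
      abs_sub_le_of_abs_stepTwoLaplacian_lt hd hε (hw0 i) (fun k hk => by
        rw [hwL i k hk]
        exact (PiLp.norm_apply_le (F k) i).trans_lt (hF k)) hk l
    refine (Finset.sum_le_sum fun i _ => h2 i).trans ?_
    simp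
  refine ⟨fun k => ∑ l, (conjSign l : ℝ) • leftMul l (W (k + unitZ l) - W (k - unitZ l)), ?_, ?_⟩
  · intro k hk
    have hk2 : k ∈ cubeZ (2 * d) := by
      rw [mem_cubeZ] at *
      intro i
      have := hk i
      push_cast
      linarith
    rw [← hWL k hk2]
    have h := sum_leftMul_leftMul_symm
      (fun m l => W (k + unitZ m + unitZ l) - W (k + unitZ m - unitZ l)
        - (W (k - unitZ m + unitZ l) - W (k - unitZ m - unitZ l))) ?_
    · simp only [← Finset.sum_sub_distrib, ← smul_sub, ← map_sub]
      rw [h]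
      unfold stepTwoLaplacian
      refine Finset.sum_congr rfl fun l _ => ?_
      rw [add_sub_cancel_right, sub_add_cancel, two_smul]
      abel
    · intro l m
      have e1 : k + unitZ l + unitZ m = k + unitZ m + unitZ l := by abel
      have e2 : k + unitZ l - unitZ m = k - unitZ m + unitZ l := by abel
      have e3 : k - unitZ l + unitZ m = k + unitZ m - unitZ l := by abel
      have e4 : k - unitZ l - unitZ m = k - unitZ m - unitZ l := by abel
      simp only [e1, e2, e3, e4]
      abel
  · intro ε hε hF k hk
    refine (norm_sum_le _ _).trans ?_
    have h1 : ∀ l, ‖(conjSign l : ℝ) • leftMul l (W (k + unitZ l) - W (k - unitZ l))‖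
        ≤ leftMulBound * (8 * (1536 * d * ε)) := by
      intro l
      have h2 : ‖(conjSign l : ℝ)‖ = 1 := by
        unfold conjSign
        split_ifs <;> simp
      rw [norm_smul, h2, one_mul]
      exact (norm_leftMul_le l _).trans
        (mul_le_mul_of_nonneg_left (hgrad ε hε hF k hk l) leftMulBound_nonneg)
    refine (Finset.sum_le_sum fun l _ => h1 l).trans ?_
    simp
    linarith

/-! ### Extension of `C¹` functions across a `C¹` boundary -/

section Reflection

variable {E F : Type*} [NormedAddCommGroup E] [NormedSpace ℝ E] [NormedAddCommGroup F]
  [NormedSpace ℝ F]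

/-- A `C¹` function on one side of a hyperplane extends across it locally: with `P` the projection
to and `R` the reflection in the hyperplane, `y ↦ 2 g (P y) - g (R y)` is an extension, because
`2 P - R` is the identity. -/
theorem exists_contDiffOn_extension_of_halfSpace (ℓ : E →L[ℝ] ℝ) (v : E) (hv : ℓ v = 1)
    {V : Set E} (hV : IsOpen V) {g : E → F} (hg : ContDiffOn ℝ 1 g ({y | ℓ y ≤ 0} ∩ V))
    {y₀ : E} (hy₀ : y₀ ∈ V) (hℓ : ℓ y₀ = 0) :
    ∃ V' ⊆ V, IsOpen V' ∧ y₀ ∈ V' ∧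
      ∃ G : E → F, ContDiffOn ℝ 1 G V' ∧ ∀ y ∈ V', ℓ y ≤ 0 → G y = g y := by
  let P : E →L[ℝ] E := ContinuousLinearMap.id ℝ E - ℓ.smulRight v
  let R : E →L[ℝ] E := ContinuousLinearMap.id ℝ E - (2 : ℝ) • ℓ.smulRight v
  have hP : ∀ y, P y = y - ℓ y • v := fun y => rfl
  have hR : ∀ y, R y = y - (2 : ℝ) • ℓ y • v := fun y => rfl
  have hPR : (2 : ℝ) • P - R = ContinuousLinearMap.id ℝ E := by
    ext y
    show (2 : ℝ) • P y - R y = y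
    rw [hP, hR]
    module
  have hℓP : ∀ y, ℓ (P y) = 0 := fun y => by rw [hP]; simp [hv]
  have hℓR : ∀ y, ℓ (R y) = -ℓ y := fun y => by rw [hR]; simp [hv]; ring
  have hP0 : ∀ y, ℓ y = 0 → P y = y := fun y h => by rw [hP, h]; simp
  have hR0 : ∀ y, ℓ y = 0 → R y = y := fun y h => by rw [hR, h]; simp
  let V' : Set E := V ∩ (P ⁻¹' V ∩ R ⁻¹' V)
  have hV' : IsOpen V' := hV.inter ((hV.preimage P.continuous).inter (hV.preimage R.continuous))
  let S : Set E := {y | ℓ y ≤ 0} ∩ V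
  let T : Set E := {y | 0 ≤ ℓ y} ∩ V'
  have hS : UniqueDiffOn ℝ S := by
    refine UniqueDiffOn.inter (uniqueDiffOn_convex ?_ ?_) hV
    · exact convex_halfSpace_le ℓ.isLinear 0
    · refine ⟨-v, ?_⟩
      have ho : IsOpen {y | ℓ y < 0} := isOpen_lt ℓ.continuous continuous_const
      refine interior_maximal (fun y hy => ?_) ho (?_ : ℓ (-v) < 0)
      · exact le_of_lt (show ℓ y < 0 from hy)
      · rw [map_neg, hv]; norm_num
  let g' : E → E →L[ℝ] F := fderivWithin ℝ g S
  have hg'c : ContinuousOn g' S := hg.continuousOn_fderivWithin hS le_rfl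
  have hg' : ∀ y ∈ S, HasFDerivWithinAt g (g' y) S y := fun y hy =>
    ((hg.differentiableOn one_ne_zero) y hy).hasFDerivWithinAt
  have hPT : Set.MapsTo P T S := fun y hy => ⟨(hℓP y).le, hy.2.2.1⟩
  have hRT : Set.MapsTo R T S := fun y hy => by
    refine ⟨?_, hy.2.2.2⟩
    have : 0 ≤ ℓ y := hy.1
    show ℓ (R y) ≤ 0
    rw [hℓR]; linarith
  let q : E → F := fun y => (2 : ℝ) • g (P y) - g (R y)
  let q' : E → E →L[ℝ] F := fun y => (2 : ℝ) • (g' (P y)).comp P - (g' (R y)).comp R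
  have hq' : ∀ y ∈ T, HasFDerivWithinAt q (q' y) T y := fun y hy =>
    (((hg' _ (hPT hy)).comp y P.hasFDerivWithinAt hPT).const_smul (2 : ℝ)).sub
      ((hg' _ (hRT hy)).comp y R.hasFDerivWithinAt hRT)
  have hq'c : ContinuousOn q' T := by
    refine ContinuousOn.sub (ContinuousOn.const_smul ?_ (2 : ℝ)) ?_
    · exact (hg'c.comp P.continuous.continuousOn hPT).clm_comp continuousOn_const
    · exact (hg'c.comp R.continuous.continuousOn hRT).clm_comp continuousOn_const
  have hq0 : ∀ y, ℓ y = 0 → q y = g y := fun y h => by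
    simp only [q, hP0 y h, hR0 y h, two_smul]; abel
  have hq0' : ∀ y, ℓ y = 0 → q' y = g' y := fun y h => by
    have : q' y = (g' y).comp ((2 : ℝ) • P - R) := by
      simp only [q', hP0 y h, hR0 y h]
      ext z
      simp
    rw [this, hPR, ContinuousLinearMap.comp_id]
  classical
  -- `G` equals `g` where `ℓ ≤ 0` and `q` where `0 ≤ ℓ`, and likewise for the derivatives.
  let G : E → F := fun y => if ℓ y ≤ 0 then g y else q y
  let G' : E → E →L[ℝ] F := fun y => if ℓ y ≤ 0 then g' y else q' y
  have hGT : ∀ y, 0 ≤ ℓ y → G y = q y := fun y hy => by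
    by_cases h : ℓ y ≤ 0
    · simp only [G, if_pos h]; exact (hq0 y (le_antisymm h hy)).symm
    · simp only [G, if_neg h]
  have hGT' : ∀ y, 0 ≤ ℓ y → G' y = q' y := fun y hy => by
    by_cases h : ℓ y ≤ 0
    · simp only [G', if_pos h]; exact (hq0' y (le_antisymm h hy)).symm
    · simp only [G', if_neg h]
  have hGS : ∀ y, ℓ y ≤ 0 → G y = g y := fun y hy => by simp only [G, if_pos hy]
  have hGS' : ∀ y, ℓ y ≤ 0 → G' y = g' y := fun y hy => by simp only [G', if_pos hy]
  have hcl : IsClosed {y | ℓ y ≤ 0} := isClosed_le ℓ.continuous continuous_const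
  have hcl' : IsClosed {y | 0 ≤ ℓ y} := isClosed_le continuous_const ℓ.continuous
  have hderiv : ∀ y ∈ V', HasFDerivAt G (G' y) y := by
    intro y hy
    have h1 : HasFDerivWithinAt G (G' y) S y := by
      by_cases h : ℓ y ≤ 0
      · rw [hGS' y h]
        exact (hg' y ⟨h, hy.1⟩).congr (fun z hz => hGS z hz.1) (hGS y h)
      · refine HasFDerivWithinAt.of_notMem_closure fun hc => h ?_
        exact hcl.closure_subset_iff.2 Set.inter_subset_left hc
    have h2 : HasFDerivWithinAt G (G' y) T y := by
      by_cases h : 0 ≤ ℓ y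
      · rw [hGT' y h]
        exact (hq' y ⟨h, hy⟩).congr (fun z hz => hGT z hz.1) (hGT y h)
      · refine HasFDerivWithinAt.of_notMem_closure fun hc => h ?_
        exact hcl'.closure_subset_iff.2 Set.inter_subset_left hc
    refine (h1.union h2).hasFDerivAt (Filter.mem_of_superset (hV'.mem_nhds hy) fun z hz => ?_)
    rcases le_total (ℓ z) 0 with h | h
    · exact Or.inl ⟨h, hz.1⟩
    · exact Or.inr ⟨h, hz⟩
  have hcont : ContinuousOn G' V' := by
    refine ContinuousOn.if (fun y hy => ?_) (hg'c.mono ?_) (hq'c.mono ?_)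
    · exact (hq0' y (frontier_le_subset_eq ℓ.continuous continuous_const hy.2)).symm
    · rw [hcl.closure_eq]
      exact fun y hy => ⟨hy.2, hy.1.1⟩
    · refine fun y hy => ⟨?_, hy.1⟩
      refine hcl'.closure_subset_iff.2 ?_ hy.2
      exact fun z hz => (not_le.1 hz).le
  refine ⟨V', Set.inter_subset_left, hV', ⟨hy₀, ?_, ?_⟩, G, ?_, fun y _ h => hGS y h⟩
  · show P y₀ ∈ V
    rwa [hP0 y₀ hℓ]
  · show R y₀ ∈ V
    rwa [hR0 y₀ hℓ]
  · rw [show (1 : WithTop ℕ∞) = 0 + 1 by simp,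
      contDiffOn_succ_iff_hasFDerivWithinAt_of_uniqueDiffOn hV'.uniqueDiffOn]
    exact ⟨by simp, G', contDiffOn_zero.2 hcont, fun y hy => (hderiv y hy).hasFDerivWithinAt⟩

end Reflection

/-- Local extension at a boundary point `p`. The map `Φ x = x + (ρ x - ℓ x) v`, where `ℓ = dρ(p)`
and `ℓ v = 1`, is a local diffeomorphism with `ℓ ∘ Φ = ρ`, so it straightens the boundary. -/
theorem exists_local_extension_of_mem_frontier {B : Set R8} (hBo : IsOpen B)
    (hB : HasC3Boundary B) {f : R8 → Octonion} (hf : ContDiffOn ℝ 1 f (closure B)) {p : R8}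
    (hp : p ∈ frontier B) :
    ∃ N ∈ 𝓝 p, ∃ G : R8 → Octonion, ContDiffOn ℝ 1 G N ∧ ∀ y ∈ N, y ∈ closure B → G y = f y := by
  obtain ⟨U, ρ, hU, hpU, hρ, hdρ, hBρ⟩ := hB p hp
  have hρc : ∀ x ∈ U, ContinuousAt ρ x := fun x hx =>
    hρ.continuousOn.continuousAt (hU.mem_nhds hx)
  have hle : ∀ x ∈ U, x ∈ closure B → ρ x ≤ 0 := by
    intro x hx hxB
    by_contra! hpos
    have h1 : ∀ᶠ y in 𝓝 x, 0 < ρ y ∧ y ∈ U :=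
      ((hρc x hx).eventually (lt_mem_nhds hpos)).and (hU.mem_nhds hx)
    obtain ⟨y, ⟨hy, hyU⟩, hyB⟩ := mem_closure_iff_nhds.1 hxB _ h1
    exact absurd ((hBρ y hyU).1 hyB) (not_lt.2 hy.le)
  have hρp : ρ p = 0 := by
    refine le_antisymm (hle p hpU (frontier_subset_closure hp)) ?_
    by_contra! h
    have := (hBρ p hpU).2 h
    rw [hBo.frontier_eq] at hp
    exact hp.2 this
  set ℓ : R8 →L[ℝ] ℝ := fderiv ℝ ρ p with hℓ
  obtain ⟨v, hv⟩ : ∃ v, ℓ v = 1 := by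
    obtain ⟨u, hu⟩ : ∃ u, ℓ u ≠ 0 := by
      by_contra! h
      exact hdρ (by ext u; simpa using h u)
    exact ⟨(ℓ u)⁻¹ • u, by simp [hu]⟩
  have hρat : ContDiffAt ℝ 1 ρ p := (hρ.contDiffAt (hU.mem_nhds hpU)).of_le (by norm_num)
  let Φ : R8 → R8 := fun x => x + (ρ x - ℓ x) • v
  have hℓΦ : ∀ x, ℓ (Φ x) = ρ x := fun x => by simp [Φ, hv]
  have hΦ : ContDiffAt ℝ 1 Φ p :=
    contDiffAt_id.add ((hρat.sub ℓ.contDiff.contDiffAt).smul contDiffAt_const)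
  have hΦ' : HasFDerivAt Φ ((ContinuousLinearEquiv.refl ℝ R8 : R8 ≃L[ℝ] R8) : R8 →L[ℝ] R8) p := by
    have h1 : HasFDerivAt ρ ℓ p := (hρat.differentiableAt one_ne_zero).hasFDerivAt
    have h2 := (hasFDerivAt_id p).add ((h1.sub ℓ.hasFDerivAt).smul_const v)
    have h3 : ContinuousLinearMap.id ℝ R8 + (ℓ - ℓ).smulRight v
        = ((ContinuousLinearEquiv.refl ℝ R8 : R8 ≃L[ℝ] R8) : R8 →L[ℝ] R8) := by
      ext x
      simp
    rw [h3] at h2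
    exact h2
  let e := hΦ.toOpenPartialHomeomorph Φ hΦ' one_ne_zero
  have he : ∀ x, e x = Φ x := fun x => rfl
  have hps : p ∈ e.source := hΦ.mem_toOpenPartialHomeomorph_source hΦ' one_ne_zero
  have hpt : Φ p ∈ e.target := e.map_source hps
  have hsymm : e.symm (Φ p) = p := e.left_inv hps
  have hinv : ContDiffAt ℝ 1 e.symm (Φ p) := hΦ.to_localInverse hΦ' one_ne_zero
  have hev : ∀ᶠ y in 𝓝 (Φ p), y ∈ e.target ∧ ContDiffAt ℝ 1 e.symm y ∧ e.symm y ∈ U := by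
    refine (e.open_target.eventually_mem hpt).and ((hinv.eventually (by simp)).and ?_)
    exact hinv.continuousAt.eventually (by rw [hsymm]; exact hU.mem_nhds hpU)
  obtain ⟨V, hVsub, hVo, hpV⟩ := mem_nhds_iff.1 hev
  have hmaps : Set.MapsTo e.symm ({y | ℓ y ≤ 0} ∩ V) (closure B) := by
    rintro y ⟨hy, hyV⟩
    have hlt : ∀ z ∈ V, ℓ z < 0 → e.symm z ∈ B := by
      intro z hz hlz
      have hz' := hVsub hz
      refine (hBρ _ hz'.2.2).2 ?_
      rw [← hℓΦ, ← he, e.right_inv hz'.1]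
      exact hlz
    have hpath : Tendsto (fun t : ℝ => y - t • v) (𝓝[>] 0) (𝓝 y) := by
      have : Continuous fun t : ℝ => y - t • v := by fun_prop
      have h0 := this.tendsto 0
      simp only [zero_smul, sub_zero] at h0
      exact h0.mono_left nhdsWithin_le_nhds
    refine mem_closure_of_tendsto ((hVsub hyV).2.1.continuousAt.tendsto.comp hpath) ?_
    filter_upwards [hpath (hVo.mem_nhds hyV), self_mem_nhdsWithin] with t ht ht0
    refine hlt _ ht ?_
    have h1 : ℓ y ≤ 0 := hy
    have h2 : (0 : ℝ) < t := ht0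
    rw [map_sub, map_smul, hv, smul_eq_mul]
    linarith
  have hg : ContDiffOn ℝ 1 (f ∘ e.symm) ({y | ℓ y ≤ 0} ∩ V) :=
    hf.comp (fun y hy => (hVsub hy.2).2.1.contDiffWithinAt) hmaps
  obtain ⟨V', hV'V, hV'o, hpV', G, hG, hGg⟩ :=
    exists_contDiffOn_extension_of_halfSpace ℓ v hv hVo hg hpV (by rw [hℓΦ, hρp])
  have hN : ∀ᶠ x in 𝓝 p, Φ x ∈ V' ∧ x ∈ e.source ∧ x ∈ U ∧ ContDiffAt ℝ 1 Φ x :=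
    (hΦ.continuousAt.eventually (hV'o.mem_nhds hpV')).and
      ((e.open_source.eventually_mem hps).and ((hU.eventually_mem hpU).and (hΦ.eventually (by simp))))
  refine ⟨_, hN, G ∘ Φ, ?_, ?_⟩
  · exact hG.comp (fun x hx => hx.2.2.2.contDiffWithinAt) fun x hx => hx.1
  · rintro x ⟨hxV, hxs, hxU, -⟩ hxB
    have h1 := hGg (Φ x) hxV (by rw [hℓΦ]; exact hle x hxU hxB)
    show G (Φ x) = f x
    rw [h1, Function.comp_apply, ← he, e.left_inv hxs]

open scoped Manifold in
/-- The local extensions are glued by a partition of unity: being an extension of `f` is a convex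
condition at each point. -/
theorem exists_contDiff_extension {B : Set R8} (hBo : IsOpen B) (hB : HasC3Boundary B)
    {f : R8 → Octonion} (hf : ContDiffOn ℝ 1 f (closure B)) :
    ∃ G : R8 → Octonion, ContDiff ℝ 1 G ∧ ∀ x ∈ closure B, G x = f x := by
  have ht : ∀ x, Convex ℝ {y : Octonion | x ∈ closure B → y = f x} := by
    intro x
    by_cases hx : x ∈ closure B
    · simp [hx]
    · simpa [hx] using convex_univ
  obtain ⟨G, hG⟩ := exists_contMDiffMap_forall_mem_convex_of_local (n := 1) 𝓘(ℝ, R8) ht (by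
    intro x
    by_cases hx : x ∈ closure B
    · by_cases hxB : x ∈ B
      · exact ⟨B, hBo.mem_nhds hxB, f, contMDiffOn_iff_contDiffOn.2 (hf.mono subset_closure),
          fun y _ _ => rfl⟩
      · obtain ⟨N, hN, G, hG, hGf⟩ := exists_local_extension_of_mem_frontier hBo hB hf
          (p := x) (by rw [hBo.frontier_eq]; exact ⟨hx, hxB⟩)
        exact ⟨N, hN, G, contMDiffOn_iff_contDiffOn.2 hG, hGf⟩
    · exact ⟨(closure B)ᶜ, isClosed_closure.isOpen_compl.mem_nhds hx, fun _ => 0,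
        contMDiffOn_const, fun y hy hy' => absurd hy' hy⟩)
  exact ⟨G, contMDiff_iff_contDiff.1 G.contMDiff, hG⟩

/-! ### Lattice points -/

/-- The point `h k` of the lattice `(hℤ)⁸`. -/
noncomputable def latticePoint (h : ℝ) (k : Fin 8 → ℤ) : R8 := WithLp.toLp 2 fun i => h * k i

theorem latticePoint_apply (h : ℝ) (k : Fin 8 → ℤ) (i : Fin 8) : latticePoint h k i = h * k i := rfl

theorem latticePoint_mem_hLattice (h : ℝ) (k : Fin 8 → ℤ) : latticePoint h k ∈ hLattice h :=
  fun i => ⟨k i, rfl⟩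

theorem exists_latticePoint_eq {h : ℝ} {x : R8} (hx : x ∈ hLattice h) :
    ∃ k, latticePoint h k = x := by
  choose k hk using hx
  exact ⟨k, by ext i; rw [latticePoint_apply, hk]⟩

theorem latticePoint_add_unitZ (h : ℝ) (k : Fin 8 → ℤ) (l : Fin 8) :
    latticePoint h (k + unitZ l) = latticePoint h k + h • stdE l := by
  ext i
  by_cases hi : i = l
  · subst hi; simp [latticePoint, stdE, unitZ]; ring
  · simp [latticePoint, stdE, unitZ, hi]

theorem latticePoint_sub_unitZ (h : ℝ) (k : Fin 8 → ℤ) (l : Fin 8) :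
    latticePoint h (k - unitZ l) = latticePoint h k - h • stdE l := by
  rw [eq_sub_iff_add_eq, ← latticePoint_add_unitZ, sub_add_cancel]

/-- The index of a lattice point nearest to `x`. -/
noncomputable def latticeIndex (h : ℝ) (x : R8) : Fin 8 → ℤ := fun i => round (x i / h)

theorem latticeIndex_latticePoint {h : ℝ} (hh : h ≠ 0) (k : Fin 8 → ℤ) :
    latticeIndex h (latticePoint h k) = k := by
  funext i
  simp [latticeIndex, latticePoint_apply, hh]

theorem abs_sub_latticeIndex_le {h : ℝ} (hh : 0 < h) (x : R8) (i : Fin 8) :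
    |x i - h * latticeIndex h x i| ≤ h / 2 := by
  have h1 := abs_sub_round (x i / h)
  have h2 : x i - h * latticeIndex h x i = h * (x i / h - round (x i / h)) := by
    rw [mul_sub, mul_div_cancel₀ _ hh.ne']; rfl
  rw [h2, abs_mul, abs_of_pos hh]
  linarith [mul_le_mul_of_nonneg_left h1 hh.le]

theorem discreteD_latticePoint (h : ℝ) (f : R8 → Octonion) (k : Fin 8 → ℤ) :
    discreteD h f (latticePoint h k) = (2 * h)⁻¹ •
      ∑ l, leftMul l (f (latticePoint h (k + unitZ l)) - f (latticePoint h (k - unitZ l))) := by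
  rw [discreteD_eq]
  simp only [latticePoint_add_unitZ, latticePoint_sub_unitZ]

/-- Lattice neighbours of a point of `A \ ∂A` belong to `A`. -/
theorem mem_of_mem_latticeNbhd {h : ℝ} {A : Set R8} {x y : R8} (hx : x ∈ hLattice h) (hxA : x ∈ A)
    (hxb : x ∉ discreteBoundary h A) (hy : y ∈ latticeNbhd h x) (hyL : y ∈ hLattice h) : y ∈ A := by
  by_contra hyA
  exact hxb ⟨hx, ⟨x, Or.inl rfl, hxA⟩, ⟨y, hy, hyL, hyA⟩⟩

theorem latticePoint_add_unitZ_mem {h : ℝ} {A : Set R8} {k : Fin 8 → ℤ} (hA : latticePoint h k ∈ A)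
    (hb : latticePoint h k ∉ discreteBoundary h A) (l : Fin 8) :
    latticePoint h (k + unitZ l) ∈ A :=
  mem_of_mem_latticeNbhd (latticePoint_mem_hLattice h k) hA hb
    (Or.inr ⟨l, Or.inl (latticePoint_add_unitZ h k l)⟩) (latticePoint_mem_hLattice h _)

theorem latticePoint_sub_unitZ_mem {h : ℝ} {A : Set R8} {k : Fin 8 → ℤ} (hA : latticePoint h k ∈ A)
    (hb : latticePoint h k ∉ discreteBoundary h A) (l : Fin 8) :
    latticePoint h (k - unitZ l) ∈ A :=
  mem_of_mem_latticeNbhd (latticePoint_mem_hLattice h k) hA hb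
    (Or.inr ⟨l, Or.inr (latticePoint_sub_unitZ h k l)⟩) (latticePoint_mem_hLattice h _)

/-! ### Consistency of the discrete operator -/

theorem norm_stdE (l : Fin 8) : ‖stdE l‖ = 1 := by simp [stdE]

/-- The mean value inequality for `D^h f - D f`. -/
theorem norm_discreteD_sub_diracD_le {f : R8 → Octonion} {x : R8} {h ε : ℝ} (hh : 0 < h)
    (hf : ∀ z ∈ Metric.closedBall x h, DifferentiableAt ℝ f z)
    (hε : ∀ z ∈ Metric.closedBall x h, ‖fderiv ℝ f z - fderiv ℝ f x‖ ≤ ε) :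
    ‖discreteD h f x - diracD f x‖ ≤ 8 * (leftMulBound * ε) := by
  have h1 : discreteD h f x - diracD f x = ∑ l, leftMul l
      ((2 * h)⁻¹ • (f (x + h • stdE l) - f (x - h • stdE l)) - fderiv ℝ f x (stdE l)) := by
    rw [discreteD_eq, diracD_eq, Finset.smul_sum, ← Finset.sum_sub_distrib]
    simp only [map_sub, map_smul]
  have h2 : ∀ l, ‖(2 * h)⁻¹ • (f (x + h • stdE l) - f (x - h • stdE l))
      - fderiv ℝ f x (stdE l)‖ ≤ ε := by
    intro l
    have hs : ‖h • stdE l‖ = h := by rw [norm_smul, norm_stdE, mul_one, Real.norm_of_nonneg hh.le]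
    have h3 := (convex_closedBall x h).norm_image_sub_le_of_norm_fderiv_le' hf hε
      (x := x - h • stdE l) (y := x + h • stdE l) (by simp [hs]) (by simp [hs])
    have h4 : x + h • stdE l - (x - h • stdE l) = (2 * h) • stdE l := by module
    have h5 : (2 * h)⁻¹ • (f (x + h • stdE l) - f (x - h • stdE l)) - fderiv ℝ f x (stdE l)
        = (2 * h)⁻¹ • (f (x + h • stdE l) - f (x - h • stdE l)
          - fderiv ℝ f x ((2 * h) • stdE l)) := by
      rw [map_smul, smul_sub _ _ ((2 * h) • _), smul_smul, inv_mul_cancel₀ (by positivity),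
        one_smul]
    rw [h4, norm_smul, norm_stdE, mul_one, Real.norm_of_nonneg (by positivity)] at h3
    rw [h5, norm_smul, Real.norm_of_nonneg (by positivity), inv_mul_le_iff₀ (by positivity)]
    linarith
  rw [h1]
  refine (norm_sum_le _ _).trans ((Finset.sum_le_sum fun l _ => (norm_leftMul_le l _).trans
    (mul_le_mul_of_nonneg_left (h2 l) leftMulBound_nonneg)).trans ?_)
  simp

/-- On compact sets `D^h f` converges uniformly to `D f`. -/
theorem eventually_norm_discreteD_sub_diracD_le {O K : Set R8} (hO : IsOpen O) (hK : IsCompact K)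
    (hKO : K ⊆ O) {f : R8 → Octonion} (hf : ContDiffOn ℝ 1 f O) {ε : ℝ} (hε : 0 < ε) :
    ∀ᶠ h in 𝓝[>] (0 : ℝ), ∀ x ∈ K, ‖discreteD h f x - diracD f x‖ ≤ ε := by
  obtain ⟨δ₀, hδ₀, hthick⟩ := hK.exists_cthickening_subset_open hO hKO
  have huc := hK.cthickening.uniformContinuousOn_of_continuous
    ((hf.continuousOn_fderiv_of_isOpen hO le_rfl).mono hthick)
  have hC := leftMulBound_nonneg
  obtain ⟨δ₁, hδ₁, hδ⟩ := Metric.uniformContinuousOn_iff_le.1 huc (ε / (8 * (leftMulBound + 1)))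
    (by positivity)
  filter_upwards [Ioo_mem_nhdsGT (lt_min hδ₀ hδ₁)] with h hh x hx
  have hball : Metric.closedBall x h ⊆ Metric.cthickening δ₀ K :=
    (Metric.closedBall_subset_cthickening hx h).trans
      (Metric.cthickening_mono (hh.2.le.trans (min_le_left _ _)) K)
  refine (norm_discreteD_sub_diracD_le (ε := ε / (8 * (leftMulBound + 1))) hh.1 (fun z hz => ?_)
    fun z hz => ?_).trans ?_
  · exact (hf.differentiableOn one_ne_zero).differentiableAt (hO.mem_nhds (hthick (hball hz)))
  · rw [← dist_eq_norm]
    exact hδ z (hball hz) x (hball (Metric.mem_closedBall_self hh.1.le))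
      ((Metric.mem_closedBall.1 hz).trans (hh.2.le.trans (min_le_right _ _)))
  · rw [mul_div_assoc', mul_div_assoc', div_le_iff₀ (by positivity)]
    nlinarith

theorem continuousOn_diracD {O : Set R8} (hO : IsOpen O) {f : R8 → Octonion}
    (hf : ContDiffOn ℝ 1 f O) : ContinuousOn (diracD f) O := by
  have h := hf.continuousOn_fderiv_of_isOpen hO le_rfl
  have h2 : ContinuousOn (fun x => ∑ l, leftMul l (fderiv ℝ f x (stdE l))) O :=
    continuousOn_finsetSum _ fun l _ =>
      (leftMul l).continuous.comp_continuousOn (h.clm_apply continuousOn_const)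
  exact h2

/-! ### Regular functions are scaling limits -/

theorem eventually_forall_lt_of_tendsto_iSup {S : ℝ → Set R8} {φ : ℝ → R8 → ℝ≥0∞}
    (hφ : Tendsto (fun h => ⨆ a ∈ S h, φ h a) (𝓝[>] 0) (𝓝 0)) {δ : ℝ} (hδ : 0 < δ) :
    ∀ᶠ h in 𝓝[>] (0 : ℝ), ∀ a ∈ S h, φ h a < ENNReal.ofReal δ := by
  filter_upwards [(tendsto_order.1 hφ).2 _ (ENNReal.ofReal_pos.2 hδ)] with h hh a ha
  exact (le_iSup₂ (f := fun a (_ : a ∈ S h) => φ h a) a ha).trans_lt hh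

/-- The correction of a function `G` on a bounded set `A` of lattice points to a discrete regular
function costs no more than a multiple of `sup ‖D^h G‖`. -/
theorem exists_isDiscreteRegular_near {h R : ℝ} (hh : 0 < h) (hR : 0 < R) {A : Set R8}
    (hA : A ⊆ hLattice h) (G : R8 → Octonion) :
    ∃ g : R8 → Octonion, IsDiscreteRegular h A g ∧ (A ⊆ Metric.closedBall 0 R →
      ∀ ε > 0, (∀ x ∈ A, ‖discreteD h G x‖ < ε) → ∀ x ∈ A,
        ‖G x - g x‖ ≤ 64 * leftMulBound * (3072 * ((R + h) * ε))) := by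
  by_cases hAR : A ⊆ Metric.closedBall 0 R
  swap
  · exact ⟨fun _ => 0, fun x _ => by simp [discreteD_eq], fun h => absurd h hAR⟩
  classical
  -- The cube of half side `d` contains the indices of all points of `A`.
  set d : ℕ := ⌈R / h⌉₊ with hd
  have hd1 : 1 ≤ d := Nat.one_le_iff_ne_zero.2 (Nat.ceil_pos.2 (by positivity)).ne'
  have hdh : h * d ≤ R + h := by
    have := (Nat.ceil_lt_add_one (show 0 ≤ R / h by positivity)).le
    calc h * d ≤ h * (R / h + 1) := mul_le_mul_of_nonneg_left this hh.le
      _ = R + h := by field_simp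
  have hcube : ∀ k, latticePoint h k ∈ A → k ∈ cubeZ d := by
    intro k hk
    rw [mem_cubeZ]
    intro i
    have h1 : ‖latticePoint h k i‖ ≤ R :=
      (PiLp.norm_apply_le _ i).trans (by simpa using hAR hk)
    rw [latticePoint_apply, norm_mul, Real.norm_of_nonneg hh.le, Real.norm_eq_abs] at h1
    have h2 : |(k i : ℝ)| ≤ R / h := by rw [le_div_iff₀ hh]; linarith
    have h3 : |(k i : ℝ)| ≤ d := h2.trans (Nat.le_ceil _)
    exact_mod_cast h3
  let F : (Fin 8 → ℤ) → Octonion := fun k =>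
    if latticePoint h k ∈ A then (2 * h) • discreteD h G (latticePoint h k) else 0
  obtain ⟨U, hU, hUb⟩ := exists_discrete_cauchyFueter_solution hd1 F
  let u : R8 → Octonion := fun x => U (latticeIndex h x)
  have hu : ∀ k, u (latticePoint h k) = U k := fun k => by
    simp only [u, latticeIndex_latticePoint hh.ne']
  refine ⟨fun x => G x - u x, ?_, ?_⟩
  · rintro x ⟨hxA, -⟩
    obtain ⟨k, rfl⟩ := exists_latticePoint_eq (hA hxA)
    rw [discreteD_sub, discreteD_latticePoint h u]
    simp only [hu]
    rw [hU k (hcube k hxA)]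
    simp only [F, if_pos hxA]
    rw [smul_smul, inv_mul_cancel₀ (by positivity), one_smul, sub_self]
  · intro _ ε hε hF x hxA
    obtain ⟨k, rfl⟩ := exists_latticePoint_eq (hA hxA)
    rw [sub_sub_cancel, hu]
    have hFb : ∀ j, ‖F j‖ < 2 * h * ε := by
      intro j
      by_cases hj : latticePoint h j ∈ A
      · simp only [F, if_pos hj]
        rw [norm_smul, Real.norm_of_nonneg (by positivity)]
        exact mul_lt_mul_of_pos_left (hF _ hj) (by positivity)
      · simp only [F, if_neg hj, norm_zero]
        positivity
    refine (hUb _ (by positivity) hFb k (hcube k hxA)).trans ?_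
    have h1 : 1536 * (d : ℝ) * (2 * h * ε) ≤ 3072 * ((R + h) * ε) := by
      have := mul_le_mul_of_nonneg_right hdh hε.le
      linarith
    exact mul_le_mul_of_nonneg_left h1 (mul_nonneg (by norm_num) leftMulBound_nonneg)

/-- A regular function is a scaling limit: its `C¹` extension `G` has `D G = 0` on the closure of
`B`, so `D^h G` is uniformly small on `B^h`, and hence so is the correction to a discrete regular
function. -/
theorem isScalingLimitOfRegular_of_isOctRegularOn {B : Set R8} (hBo : IsOpen B)
    (hBb : Bornology.IsBounded B) (hBd : HasC3Boundary B) {Bh : ℝ → Set R8}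
    (hBh : ∀ h > 0, Bh h ⊆ hLattice h)
    (hconv : Tendsto (fun h => ⨆ a ∈ Bh h, Metric.infEDist a (closure B)) (𝓝[>] 0) (𝓝 0))
    {f : R8 → Octonion} (hf : ContDiffOn ℝ 1 f (closure B)) (hreg : IsOctRegularOn f B) :
    IsScalingLimitOfRegular B Bh f := by
  obtain ⟨G, hG, hGf⟩ := exists_contDiff_extension hBo hBd hf
  obtain ⟨R₀, hR₀⟩ := hBb.closure.subset_closedBall 0
  set R : ℝ := max R₀ 0 + 1 with hR
  have hRpos : 0 < R := by positivity
  have hcomp : IsCompact (closure B) := hBb.isCompact_closure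
  have hGD : Continuous (diracD G) := by
    rw [← continuousOn_univ]
    exact continuousOn_diracD isOpen_univ hG.contDiffOn
  have hGB : ∀ x ∈ closure B, diracD G x = 0 := by
    have h1 : ∀ x ∈ B, diracD G x = 0 := by
      intro x hx
      have h2 : G =ᶠ[𝓝 x] f := by
        filter_upwards [hBo.mem_nhds hx] with y hy using hGf y (subset_closure hy)
      rw [← (hreg x hx).2]
      unfold diracD
      rw [h2.fderiv_eq]
    exact fun x hx => (isClosed_eq hGD continuous_const).closure_subset_iff.2 h1 hx
  choose! fh hfreg hfb using fun (h : ℝ) (hh : 0 < h) =>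
    exists_isDiscreteRegular_near hh hRpos (hBh h hh) G
  refine ⟨fh, fun h hh => hfreg h hh, ENNReal.tendsto_nhds_zero.2 fun η hη => ?_⟩
  obtain ⟨η', hη'0, hη'⟩ := ENNReal.lt_iff_exists_nnreal_btwn.1 hη
  have hη'pos : (0 : ℝ) < η' := by exact_mod_cast hη'0
  have hC := leftMulBound_nonneg
  set C : ℝ := 64 * leftMulBound * (3072 * (R + 1)) with hCdef
  have hC0 : 0 ≤ C := by positivity
  -- The admissible size of `D^h G` on `B^h`.
  set ε : ℝ := η' / (C + 1) with hεdef
  have hε : 0 < ε := by positivity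
  have hCε : C * ε ≤ η' := by
    rw [hεdef, mul_div_assoc', div_le_iff₀ (by positivity)]
    nlinarith
  have hopen : IsOpen {x | ‖diracD G x‖ < ε / 2} := isOpen_lt hGD.norm continuous_const
  obtain ⟨δ, hδ, hδsub⟩ := hcomp.exists_thickening_subset_open hopen
    (fun x hx => by simpa [hGB x hx] using hε)
  have hcons := eventually_norm_discreteD_sub_diracD_le isOpen_univ
    (isCompact_closedBall (0 : R8) R) (Set.subset_univ _) hG.contDiffOn (ε := ε / 2 / 2)
    (by positivity)
  filter_upwards [eventually_forall_lt_of_tendsto_iSup hconv (lt_min hδ one_pos), hcons,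
    Ioo_mem_nhdsGT one_pos] with h hclose hcons hh
  have hthick : ∀ x ∈ Bh h, x ∈ Metric.thickening δ (closure B) := fun x hx =>
    (hclose x hx).trans_le (ENNReal.ofReal_le_ofReal (min_le_left _ _))
  have hsub : Bh h ⊆ Metric.closedBall 0 R := by
    intro x hx
    have h1 : x ∈ Metric.thickening 1 (closure B) :=
      (hclose x hx).trans_le (ENNReal.ofReal_le_ofReal (min_le_right _ _))
    obtain ⟨y, hy, hxy⟩ := Metric.mem_thickening_iff.1 h1
    have h2 := hR₀ hy
    rw [Metric.mem_closedBall] at *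
    linarith [dist_triangle x y 0, le_max_left R₀ 0]
  have hsmall : ∀ x ∈ Bh h, ‖discreteD h G x‖ < ε := by
    intro x hx
    have h1 : ‖diracD G x‖ < ε / 2 := hδsub (hthick x hx)
    have h2 := hcons x (hsub hx)
    have h3 := norm_add_le (discreteD h G x - diracD G x) (diracD G x)
    rw [sub_add_cancel] at h3
    linarith
  refine iSup₂_le fun x hx => le_trans ?_ hη'.le
  have h1 := hfb h hh.1 hsub ε hε hsmall x hx.1
  rw [← hGf x (subset_closure hx.2)]
  have h2 : ‖G x - fh h x‖ ≤ η' := by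
    refine h1.trans (le_trans ?_ hCε)
    have h3 : (R + h) * ε ≤ (R + 1) * ε := by
      refine mul_le_mul_of_nonneg_right ?_ hε.le
      linarith [hh.2]
    have h4 : 64 * leftMulBound * (3072 * ((R + h) * ε))
        ≤ 64 * leftMulBound * (3072 * ((R + 1) * ε)) := by
      refine mul_le_mul_of_nonneg_left ?_ (by positivity)
      linarith
    refine h4.trans_eq ?_
    rw [hCdef]; ring
  rw [← ofReal_norm]
  exact (ENNReal.ofReal_le_ofReal h2).trans_eq (ENNReal.ofReal_coe_nnreal)

/-! ### Scaling limits are regular -/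

/-- The cube of side `n` in `ℤ⁸` with lowest corner `a`. -/
noncomputable def boxZ (a : Fin 8 → ℤ) (n : ℕ) : Finset (Fin 8 → ℤ) :=
  Fintype.piFinset fun i => Finset.Ico (a i) (a i + n)

theorem mem_boxZ {a : Fin 8 → ℤ} {n : ℕ} {k : Fin 8 → ℤ} :
    k ∈ boxZ a n ↔ ∀ i, a i ≤ k i ∧ k i < a i + n := by
  simp [boxZ]

theorem card_boxZ (a : Fin 8 → ℤ) (n : ℕ) : (boxZ a n).card = n ^ 8 := by
  simp [boxZ]

/-- The number of points of a cube whose `l`-th coordinate range is replaced by `s`. -/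
theorem card_slab (a : Fin 8 → ℤ) (n : ℕ) (l : Fin 8) (s : Finset ℤ) :
    (Fintype.piFinset (Function.update (fun i => Finset.Ico (a i) (a i + n)) l s)).card
      = s.card * n ^ 7 := by
  rw [Fintype.card_piFinset, Fintype.prod_eq_mul_prod_compl l, Function.update_self]
  congr 1
  rw [Finset.prod_congr rfl (g := fun _ => n)]
  · simp [Finset.card_compl]
  · intro i hi
    have : i ≠ l := by simpa using hi
    rw [Function.update_of_ne this]
    simp

/-- The discrete divergence theorem on a cube: the sum of a central difference only sees two
layers on each of two opposite faces. -/
theorem norm_sum_boxZ_le {g : (Fin 8 → ℤ) → Octonion} {a : Fin 8 → ℤ} {n : ℕ} {η : ℝ} (l : Fin 8)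
    (hp : ∀ k ∈ boxZ a n, ‖g (k + unitZ l)‖ ≤ η) (hm : ∀ k ∈ boxZ a n, ‖g (k - unitZ l)‖ ≤ η) :
    ‖∑ k ∈ boxZ a n, (g (k + unitZ l) - g (k - unitZ l))‖ ≤ 4 * n ^ 7 * η := by
  classical
  -- Only for `n > 0` do the hypotheses imply `0 ≤ η`.
  rcases Nat.eq_zero_or_pos n with hn | hn
  · subst hn
    have : boxZ a 0 = ∅ := by simp [← Finset.card_eq_zero, card_boxZ]
    simp [this]
  have hη : 0 ≤ η := by
    have : a ∈ boxZ a n := mem_boxZ.2 fun i => ⟨le_rfl, by omega⟩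
    exact (norm_nonneg _).trans (hp a this)
  set Qp := (boxZ a n).image (· + unitZ l) with hQp
  set Qm := (boxZ a n).image (· - unitZ l) with hQm
  have e1 : ∑ k ∈ boxZ a n, g (k + unitZ l) = ∑ k ∈ Qp, g k :=
    (Finset.sum_image fun x _ y _ h => add_right_cancel h).symm
  have e2 : ∑ k ∈ boxZ a n, g (k - unitZ l) = ∑ k ∈ Qm, g k :=
    (Finset.sum_image fun x _ y _ h => sub_left_injective h).symm
  have hQp' : ∀ k, k ∈ Qp ↔ k - unitZ l ∈ boxZ a n := by
    intro k
    simp only [hQp, Finset.mem_image]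
    exact ⟨by rintro ⟨j, hj, rfl⟩; simpa using hj, fun h => ⟨_, h, by simp⟩⟩
  have hQm' : ∀ k, k ∈ Qm ↔ k + unitZ l ∈ boxZ a n := by
    intro k
    simp only [hQm, Finset.mem_image]
    exact ⟨by rintro ⟨j, hj, rfl⟩; simpa using hj, fun h => ⟨_, h, by simp⟩⟩
  have hmem : ∀ k : Fin 8 → ℤ, (∀ i, i ≠ l → a i ≤ k i ∧ k i < a i + n) →
      ((k ∈ Qp ↔ a l ≤ k l - 1 ∧ k l - 1 < a l + n)
        ∧ (k ∈ Qm ↔ a l ≤ k l + 1 ∧ k l + 1 < a l + n)) := by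
    intro k hk
    rw [hQp', hQm', mem_boxZ, mem_boxZ]
    constructor
    · constructor
      · intro h; simpa [unitZ_self] using h l
      · intro h i
        by_cases hi : i = l
        · subst hi; simpa [unitZ_self] using h
        · simpa [unitZ_of_ne hi] using hk i hi
    · constructor
      · intro h; simpa [unitZ_self] using h l
      · intro h i
        by_cases hi : i = l
        · subst hi; simpa [unitZ_self] using h
        · simpa [unitZ_of_ne hi] using hk i hi
  have hoff : ∀ k, k ∈ Qp ∨ k ∈ Qm → ∀ i, i ≠ l → a i ≤ k i ∧ k i < a i + n := by
    intro k hk i hi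
    rcases hk with hk | hk
    · simpa [unitZ_of_ne hi] using mem_boxZ.1 ((hQp' k).1 hk) i
    · simpa [unitZ_of_ne hi] using mem_boxZ.1 ((hQm' k).1 hk) i
  have hslab : ∀ (s : Finset ℤ) (k : Fin 8 → ℤ), (∀ i, i ≠ l → a i ≤ k i ∧ k i < a i + n) →
      k l ∈ s → k ∈ Fintype.piFinset
        (Function.update (fun i => Finset.Ico (a i) (a i + n)) l s) := by
    intro s k hk hs
    rw [Fintype.mem_piFinset]
    intro i
    by_cases hi : i = l
    · subst hi; simpa using hs
    · rw [Function.update_of_ne hi]; exact Finset.mem_Ico.2 (hk i hi)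
  have hc1 : (Qp \ Qm).card ≤ 2 * n ^ 7 := by
    refine (Finset.card_le_card (t := Fintype.piFinset (Function.update
      (fun i => Finset.Ico (a i) (a i + n)) l {a l + n - 1, a l + n})) fun k hk => ?_).trans ?_
    · rw [Finset.mem_sdiff] at hk
      have h1 := hoff k (Or.inl hk.1)
      have h2 := hmem k h1
      rw [h2.1, h2.2] at hk
      refine hslab _ k h1 ?_
      rw [Finset.mem_insert, Finset.mem_singleton]
      omega
    · rw [card_slab]
      exact Nat.mul_le_mul_right _ Finset.card_le_two
  have hc2 : (Qm \ Qp).card ≤ 2 * n ^ 7 := by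
    refine (Finset.card_le_card (t := Fintype.piFinset (Function.update
      (fun i => Finset.Ico (a i) (a i + n)) l {a l - 1, a l})) fun k hk => ?_).trans ?_
    · rw [Finset.mem_sdiff] at hk
      have h1 := hoff k (Or.inr hk.1)
      have h2 := hmem k h1
      rw [h2.1, h2.2] at hk
      refine hslab _ k h1 ?_
      rw [Finset.mem_insert, Finset.mem_singleton]
      omega
    · rw [card_slab]
      exact Nat.mul_le_mul_right _ Finset.card_le_two
  have hbound : ∀ k, k ∈ Qp ∨ k ∈ Qm → ‖g k‖ ≤ η := by
    rintro k (hk | hk)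
    · have := hp _ ((hQp' k).1 hk)
      rwa [sub_add_cancel] at this
    · have := hm _ ((hQm' k).1 hk)
      rwa [add_sub_cancel_right] at this
  have hsum : ∀ s : Finset (Fin 8 → ℤ), s.card ≤ 2 * n ^ 7 → (∀ k ∈ s, ‖g k‖ ≤ η) →
      ‖∑ k ∈ s, g k‖ ≤ 2 * n ^ 7 * η := by
    intro s hs hg
    refine (norm_sum_le _ _).trans ((Finset.sum_le_card_nsmul _ _ _ hg).trans ?_)
    rw [nsmul_eq_mul]
    refine mul_le_mul_of_nonneg_right ?_ hη
    exact_mod_cast hs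
  rw [Finset.sum_sub_distrib, e1, e2, ← Finset.sum_sdiff_sub_sum_sdiff]
  refine (norm_sub_le _ _).trans ?_
  have h1 := hsum _ hc1 fun k hk => hbound k (Or.inl (Finset.mem_sdiff.1 hk).1)
  have h2 := hsum _ hc2 fun k hk => hbound k (Or.inr (Finset.mem_sdiff.1 hk).1)
  linarith

/-- A property that passes from points of a cube in `ℤ⁸` to their neighbours holds on
the whole cube once it holds at one of its points. -/
theorem forall_of_forall_neighbour {P : (Fin 8 → ℤ) → Prop} {c : Fin 8 → ℤ} {m : ℕ}
    (hp : ∀ k, (∀ i, |k i - c i| ≤ m) → P k → ∀ l, P (k + unitZ l))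
    (hm : ∀ k, (∀ i, |k i - c i| ≤ m) → P k → ∀ l, P (k - unitZ l))
    {k₁ : Fin 8 → ℤ} (hk₁ : ∀ i, |k₁ i - c i| ≤ m) (h₁ : P k₁) :
    ∀ k, (∀ i, |k i - c i| ≤ m) → P k := by
  suffices h : ∀ (N : ℕ) (k : Fin 8 → ℤ), ∑ i, (k i - k₁ i).natAbs = N →
      (∀ i, |k i - c i| ≤ m) → P k from fun k => h _ k rfl
  intro N
  induction N with
  | zero =>
    intro k hk _
    have : k = k₁ := by
      funext i
      have := (Finset.sum_eq_zero_iff.1 hk) i (Finset.mem_univ i)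
      omega
    rwa [this]
  | succ N ih =>
    intro k hk hkc
    obtain ⟨l, hl⟩ : ∃ l, k l ≠ k₁ l := by
      by_contra! h
      simp [h] at hk
    -- Moving the coordinate `l` one step towards `k₁` stays in the cube.
    have hsum : ∀ k' : Fin 8 → ℤ, (∀ i, i ≠ l → k' i = k i) →
        (k' l - k₁ l).natAbs + 1 = (k l - k₁ l).natAbs → ∑ i, (k' i - k₁ i).natAbs = N := by
      intro k' h1 h2
      rw [Fintype.sum_eq_add_sum_compl l] at hk ⊢
      have : ∑ i ∈ ({l} : Finset (Fin 8))ᶜ, (k' i - k₁ i).natAbs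
          = ∑ i ∈ ({l} : Finset (Fin 8))ᶜ, (k i - k₁ i).natAbs :=
        Finset.sum_congr rfl fun i hi => by rw [h1 i (by simpa using hi)]
      omega
    have hc := hkc l
    have hc1 := hk₁ l
    rw [abs_le] at hc hc1
    rcases lt_or_gt_of_ne hl with hlt | hlt
    · have e : (k + unitZ l) l = k l + 1 := by simp [unitZ_self]
      have e' : ∀ i, i ≠ l → (k + unitZ l) i = k i := fun i hi => by simp [unitZ_of_ne hi]
      have hbox : ∀ i, |(k + unitZ l) i - c i| ≤ m := by
        intro i
        by_cases hi : i = l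
        · subst hi; rw [e, abs_le]; omega
        · rw [e' i hi]; exact hkc i
      have := hm _ hbox (ih _ (hsum _ e' (by rw [e]; omega)) hbox) l
      rwa [add_sub_cancel_right] at this
    · have e : (k - unitZ l) l = k l - 1 := by simp [unitZ_self]
      have e' : ∀ i, i ≠ l → (k - unitZ l) i = k i := fun i hi => by simp [unitZ_of_ne hi]
      have hbox : ∀ i, |(k - unitZ l) i - c i| ≤ m := by
        intro i
        by_cases hi : i = l
        · subst hi; rw [e, abs_le]; omega
        · rw [e' i hi]; exact hkc i
      have := hp _ hbox (ih _ (hsum _ e' (by rw [e]; omega)) hbox) l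
      rwa [sub_add_cancel] at this

theorem norm_latticePoint_sub_le {h ρ : ℝ} {x : R8} {k : Fin 8 → ℤ}
    (hk : ∀ i, |h * k i - x i| ≤ ρ) : ‖latticePoint h k - x‖ ≤ 8 * ρ := by
  have e := (EuclideanSpace.basisFun (Fin 8) ℝ).sum_repr (latticePoint h k - x)
  rw [← e]
  refine (norm_sum_le _ _).trans ((Finset.sum_le_sum (g := fun _ => ρ) fun i _ => ?_).trans ?_)
  · rw [norm_smul, OrthonormalBasis.norm_eq_one, mul_one]
    exact hk i
  · simp

/-- For small `h`, the lattice points of a cube about `x₀` which is well inside `B` lie in the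
discrete interior of `B^h`: they are far from `∂B`, hence not in `∂B^h`, one of them is in `B^h`
as `x₀` is close to `B^h`, and the cube is connected. -/
theorem eventually_cube_subset {B : Set R8} (hBo : IsOpen B) {Bh : ℝ → Set R8}
    (hBh : ∀ h > 0, Bh h ⊆ hLattice h) (hconv : DiscreteConverges B Bh) {x₀ : R8} {r : ℝ}
    (hr : 0 < r) (hball : Metric.closedBall x₀ (32 * r) ⊆ B) :
    ∀ᶠ h in 𝓝[>] (0 : ℝ), ∀ k : Fin 8 → ℤ,
      (∀ i, |k i - latticeIndex h x₀ i| ≤ (⌊r / h⌋₊ + 1 : ℕ)) →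
        latticePoint h k ∈ Metric.closedBall x₀ (16 * r) ∧ latticePoint h k ∈ Bh h ∧
          latticePoint h k ∉ discreteBoundary h (Bh h) := by
  filter_upwards [eventually_forall_lt_of_tendsto_iSup hconv.boundary_right hr,
    eventually_forall_lt_of_tendsto_iSup hconv.closure_left hr,
    Ioo_mem_nhdsGT (half_pos hr)] with h hbdry hclos hh
  have hx₀B : x₀ ∈ B := hball (Metric.mem_closedBall_self (by positivity))
  have hfloor : h * ⌊r / h⌋₊ ≤ r := by
    have := Nat.floor_le (show 0 ≤ r / h from div_nonneg hr.le hh.1.le)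
    rwa [le_div_iff₀' hh.1] at this
  have hround := abs_sub_latticeIndex_le hh.1 x₀
  have hnear : ∀ k : Fin 8 → ℤ, (∀ i, |k i - latticeIndex h x₀ i| ≤ (⌊r / h⌋₊ + 1 : ℕ)) →
      latticePoint h k ∈ Metric.closedBall x₀ (16 * r) := by
    intro k hk
    rw [Metric.mem_closedBall, dist_eq_norm]
    have : ∀ i, |h * k i - x₀ i| ≤ 2 * r := by
      intro i
      have h1 : |(k i : ℝ) - latticeIndex h x₀ i| ≤ ⌊r / h⌋₊ + 1 := by exact_mod_cast hk i
      have h2 := mul_le_mul_of_nonneg_left h1 hh.1.le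
      rw [← abs_of_pos hh.1, ← abs_mul, abs_of_pos hh.1] at h2
      have h3 := abs_sub_le (h * (k i : ℝ)) (h * latticeIndex h x₀ i) (x₀ i)
      rw [← mul_sub, abs_sub_comm (h * (latticeIndex h x₀ i : ℝ)) (x₀ i)] at h3
      have h4 := hround i
      have h5 := hh.2
      linarith
    linarith [norm_latticePoint_sub_le this]
  have hnb : ∀ k : Fin 8 → ℤ, (∀ i, |k i - latticeIndex h x₀ i| ≤ (⌊r / h⌋₊ + 1 : ℕ)) →
      latticePoint h k ∉ discreteBoundary h (Bh h) := by
    intro k hk hkb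
    obtain ⟨y, hy, hky⟩ := Metric.infEDist_lt_iff.1 (hbdry _ hkb)
    have h1 : dist (latticePoint h k) y < r := by
      rwa [edist_dist, ENNReal.ofReal_lt_ofReal_iff hr] at hky
    have h2 := hnear k hk
    rw [Metric.mem_closedBall] at h2
    have h3 : y ∈ B := by
      apply hball
      rw [Metric.mem_closedBall]
      linarith [dist_triangle y (latticePoint h k) x₀, dist_comm y (latticePoint h k)]
    rw [hBo.frontier_eq] at hy
    exact hy.2 h3
  obtain ⟨y, hy, hxy⟩ := Metric.infEDist_lt_iff.1 (hclos x₀ (subset_closure hx₀B))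
  obtain ⟨k₁, rfl⟩ := exists_latticePoint_eq (hBh h hh.1 hy)
  have hk₁ : ∀ i, |k₁ i - latticeIndex h x₀ i| ≤ (⌊r / h⌋₊ + 1 : ℕ) := by
    intro i
    have h1 : ‖x₀ - latticePoint h k₁‖ < r := by
      rwa [edist_dist, ENNReal.ofReal_lt_ofReal_iff hr, dist_eq_norm] at hxy
    have h2 : |x₀ i - h * k₁ i| ≤ r :=
      (PiLp.norm_apply_le (x₀ - latticePoint h k₁) i).trans h1.le
    have h3 := abs_sub_le (h * (k₁ i : ℝ)) (x₀ i) (h * latticeIndex h x₀ i)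
    rw [← mul_sub, abs_mul, abs_of_pos hh.1, abs_sub_comm _ (x₀ i)] at h3
    have h4 := hround i
    have h5 : |(k₁ i : ℝ) - latticeIndex h x₀ i| ≤ r / h + 1 / 2 := by
      have : h * |(k₁ i : ℝ) - latticeIndex h x₀ i| ≤ r + h / 2 := by linarith
      rw [← le_div_iff₀' hh.1] at this
      refine this.trans_eq ?_
      have := hh.1.ne'
      field_simp
    have h6 := Nat.lt_floor_add_one (r / h)
    have h7 : |(k₁ i : ℝ) - latticeIndex h x₀ i| < ((⌊r / h⌋₊ + 1 : ℕ) : ℝ) + 1 := by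
      push_cast
      linarith
    have h8 : |k₁ i - latticeIndex h x₀ i| < ((⌊r / h⌋₊ + 1 : ℕ) : ℤ) + 1 := by exact_mod_cast h7
    omega
  have hall := forall_of_forall_neighbour (P := fun k => latticePoint h k ∈ Bh h)
    (fun k hk hkB l => latticePoint_add_unitZ_mem hkB (hnb k hk) l)
    (fun k hk hkB l => latticePoint_sub_unitZ_mem hkB (hnb k hk) l) hk₁ hy
  exact fun k hk => ⟨hnear k hk, hall k hk, hnb k hk⟩

/-- The sum of `D^h g` over a cube is bounded by the size of `g` times the number of its boundary
points. -/
theorem norm_sum_discreteD_boxZ_le {g : R8 → Octonion} {h η : ℝ} (hh : 0 < h) {a : Fin 8 → ℤ}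
    {n : ℕ} (hp : ∀ k ∈ boxZ a n, ∀ l, ‖g (latticePoint h (k + unitZ l))‖ ≤ η)
    (hm : ∀ k ∈ boxZ a n, ∀ l, ‖g (latticePoint h (k - unitZ l))‖ ≤ η) :
    ‖∑ k ∈ boxZ a n, discreteD h g (latticePoint h k)‖
      ≤ (2 * h)⁻¹ * (8 * (leftMulBound * (4 * n ^ 7 * η))) := by
  have e : ∑ k ∈ boxZ a n, discreteD h g (latticePoint h k) = (2 * h)⁻¹ • ∑ l, leftMul l
      (∑ k ∈ boxZ a n, (g (latticePoint h (k + unitZ l)) - g (latticePoint h (k - unitZ l)))) := by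
    simp only [discreteD_latticePoint, map_sum]
    rw [← Finset.smul_sum, Finset.sum_comm]
  rw [e, norm_smul, Real.norm_of_nonneg (by positivity)]
  refine mul_le_mul_of_nonneg_left ?_ (by positivity)
  refine (norm_sum_le _ _).trans ((Finset.sum_le_sum fun l _ => (norm_leftMul_le l _).trans
    (mul_le_mul_of_nonneg_left (norm_sum_boxZ_le (g := fun k => g (latticePoint h k)) l
      (fun k hk => hp k hk l) fun k hk => hm k hk l) leftMulBound_nonneg)).trans ?_)
  simp

/-- A scaling limit is regular: the mean of `D^h f` over a small cube about `x₀` is close to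
`D f(x₀)`, and it is also the mean of `D^h (f - f^h)`, which is a small boundary term. -/
theorem isOctRegularOn_of_isScalingLimitOfRegular {B : Set R8} (hBo : IsOpen B)
    {Bh : ℝ → Set R8} (hBh : ∀ h > 0, Bh h ⊆ hLattice h) (hconv : DiscreteConverges B Bh)
    {f : R8 → Octonion} (hf : ContDiffOn ℝ 1 f B) (hlim : IsScalingLimitOfRegular B Bh f) :
    IsOctRegularOn f B := by
  obtain ⟨fh, hreg, hlim⟩ := hlim
  intro x₀ hx₀
  refine ⟨(hf.differentiableOn one_ne_zero).differentiableAt (hBo.mem_nhds hx₀), ?_⟩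
  have hC := leftMulBound_nonneg
  rw [← norm_le_zero_iff]
  refine le_of_forall_pos_le_add fun ε₀ hε₀ => ?_
  obtain ⟨ε, hε, hεε₀⟩ : ∃ ε : ℝ, 0 < ε ∧ 3 * ε = ε₀ := ⟨ε₀ / 3, by positivity, by ring⟩
  -- A ball on which `D f` is nearly constant.
  have hev : ∀ᶠ x in 𝓝 x₀, x ∈ B ∧ ‖diracD f x - diracD f x₀‖ < ε := by
    refine (hBo.eventually_mem hx₀).and ?_
    have h1 := ((continuousOn_diracD hBo hf).continuousAt (hBo.mem_nhds hx₀)).eventually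
      (Metric.ball_mem_nhds _ hε)
    filter_upwards [h1] with x hx
    rwa [← dist_eq_norm]
  obtain ⟨r₀, hr₀, hr₀sub⟩ := Metric.nhds_basis_closedBall.mem_iff.1 hev
  obtain ⟨r, hr, rfl⟩ : ∃ r : ℝ, 0 < r ∧ 32 * r = r₀ := ⟨r₀ / 32, by positivity, by ring⟩
  have hball : Metric.closedBall x₀ (32 * r) ⊆ B := fun x hx => (hr₀sub hx).1
  have hnear : ∀ x ∈ Metric.closedBall x₀ (32 * r), ‖diracD f x - diracD f x₀‖ < ε :=
    fun x hx => (hr₀sub hx).2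
  have h16 : Metric.closedBall x₀ (16 * r) ⊆ Metric.closedBall x₀ (32 * r) :=
    Metric.closedBall_subset_closedBall (by linarith)
  -- The tolerance for `f - f^h` which makes the boundary sum at most `ε` on average.
  obtain ⟨η, hηpos, hηC⟩ : ∃ η : ℝ, 0 < η ∧ 16 * leftMulBound * η ≤ ε * r := by
    refine ⟨ε * r / (16 * (leftMulBound + 1)), by positivity, ?_⟩
    rw [mul_div_assoc', div_le_iff₀ (by positivity)]
    nlinarith [mul_pos hε hr]
  obtain ⟨h, hcube, hclose, hcons, hh⟩ := ((eventually_cube_subset hBo hBh hconv hr hball).and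
    ((eventually_forall_lt_of_tendsto_iSup hlim hηpos).and
      ((eventually_norm_discreteD_sub_diracD_le hBo (isCompact_closedBall x₀ (32 * r)) hball hf
        hε).and (Ioo_mem_nhdsGT hr)))).exists
  set m : ℕ := ⌊r / h⌋₊ with hm
  set c := latticeIndex h x₀ with hc
  set n : ℕ := 2 * m + 1 with hn
  set Q := boxZ (fun i => c i - m) n with hQ
  have hQc : ∀ k ∈ Q, ∀ i, |k i - c i| ≤ m := by
    intro k hk i
    have := mem_boxZ.1 hk i
    rw [abs_le]
    omega
  have hu : ∀ (l i : Fin 8), 0 ≤ unitZ l i ∧ unitZ l i ≤ 1 := by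
    intro l i
    by_cases hi : i = l
    · subst hi; simp [unitZ_self]
    · simp [unitZ_of_ne hi]
  have hQ0 := fun k hk => hcube k fun i => (hQc k hk i).trans (by push_cast; omega)
  have hQp := fun k hk l => hcube (k + unitZ l) fun i => by
    have h1 := abs_le.1 (hQc k hk i)
    have h2 := hu l i
    rw [Pi.add_apply, abs_le]
    push_cast
    omega
  have hQm := fun k hk l => hcube (k - unitZ l) fun i => by
    have h1 := abs_le.1 (hQc k hk i)
    have h2 := hu l i
    rw [Pi.sub_apply, abs_le]
    push_cast
    omega
  have hdiff : ∀ x ∈ Bh h, x ∈ Metric.closedBall x₀ (16 * r) → ‖f x - fh h x‖ ≤ η := by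
    intro x hx hxb
    have h1 := hclose x ⟨hx, hball (h16 hxb)⟩
    rw [← ofReal_norm, ENNReal.ofReal_lt_ofReal_iff hηpos] at h1
    exact h1.le
  have hsum := norm_sum_discreteD_boxZ_le (g := fun x => f x - fh h x) (η := η) hh.1
    (a := fun i => c i - m) (n := n)
    (fun k hk l => hdiff _ (hQp k hk l).2.1 (hQp k hk l).1)
    (fun k hk l => hdiff _ (hQm k hk l).2.1 (hQm k hk l).1)
  have hfh : ∀ k ∈ Q, discreteD h (fun x => f x - fh h x) (latticePoint h k)
      = discreteD h f (latticePoint h k) := by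
    intro k hk
    rw [discreteD_sub, hreg h hh.1 _ (hQ0 k hk).2, sub_zero]
  rw [Finset.sum_congr rfl hfh] at hsum
  have hconst : ‖∑ k ∈ Q, (diracD f x₀ - discreteD h f (latticePoint h k))‖
      ≤ (n : ℝ) ^ 8 * (2 * ε) := by
    refine (norm_sum_le _ _).trans ((Finset.sum_le_card_nsmul _ _ (2 * ε) fun k hk => ?_).trans ?_)
    · have hx := h16 (hQ0 k hk).1
      have h1 := hcons _ hx
      have h2 := (hnear _ hx).le
      have h3 := norm_sub_le_norm_sub_add_norm_sub (diracD f x₀) (diracD f (latticePoint h k))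
        (discreteD h f (latticePoint h k))
      rw [norm_sub_rev] at h1 h2
      linarith
    · rw [hQ, card_boxZ, nsmul_eq_mul]
      push_cast
      exact le_rfl
  rw [Finset.sum_sub_distrib, Finset.sum_const, hQ, card_boxZ, ← Nat.cast_smul_eq_nsmul ℝ] at hconst
  have hnpos : (0 : ℝ) < n := by positivity
  have hnh : r ≤ n * h := by
    have h1 := Nat.lt_floor_add_one (r / h)
    rw [div_lt_iff₀ hh.1] at h1
    have h2 : (n : ℝ) = 2 * m + 1 := by rw [hn]; push_cast; ring
    have h3 : (0 : ℝ) ≤ m * h := mul_nonneg (Nat.cast_nonneg _) hh.1.le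
    rw [h2]
    linarith
  have hboundary : (2 * h)⁻¹ * (8 * (leftMulBound * (4 * n ^ 7 * η))) ≤ (n : ℝ) ^ 8 * ε := by
    rw [inv_mul_le_iff₀ (by linarith [hh.1])]
    have h1 : ε * r ≤ ε * (n * h) := mul_le_mul_of_nonneg_left hnh hε.le
    have h2 := mul_le_mul_of_nonneg_left (hηC.trans h1) (show (0 : ℝ) ≤ 2 * n ^ 7 by positivity)
    calc 8 * (leftMulBound * (4 * (n : ℝ) ^ 7 * η))
        = 2 * (n : ℝ) ^ 7 * (16 * leftMulBound * η) := by ring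
      _ ≤ 2 * (n : ℝ) ^ 7 * (ε * (n * h)) := h2
      _ = 2 * h * ((n : ℝ) ^ 8 * ε) := by ring
  have htri := norm_add_le
    (((n ^ 8 : ℕ) : ℝ) • diracD f x₀ - ∑ k ∈ Q, discreteD h f (latticePoint h k))
    (∑ k ∈ Q, discreteD h f (latticePoint h k))
  rw [sub_add_cancel, norm_smul, Real.norm_of_nonneg (by positivity)] at htri
  push_cast at htri hconst
  have hfin : (n : ℝ) ^ 8 * ‖diracD f x₀‖ ≤ (n : ℝ) ^ 8 * (3 * ε) := by
    linarith
  have := le_of_mul_le_mul_left hfin (by positivity)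
  rw [zero_add]
  linarith

theorem mainTheorem1 (B : Set R8) (hB_open : IsOpen B) (hB_conn : IsConnected B)
    (hB_bdd : Bornology.IsBounded B) (hB_bdry : HasC3Boundary B)
    (Bh : ℝ → Set R8) (hBh : ∀ h > 0, Bh h ⊆ hLattice h)
    (hconv : DiscreteConvergesQuadratically B Bh) :
    (∀ f : R8 → Octonion, ContDiffOn ℝ 3 f (closure B) →
      (IsOctRegularOn f B ↔ IsScalingLimitOfRegular B Bh f)) ∧
    (∀ f : R8 → Octonion, ContDiffOn ℝ 3 f B →
      IsScalingLimitOfRegular B Bh f → IsOctRegularOn f B) := by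
  have hback : ∀ f : R8 → Octonion, ContDiffOn ℝ 3 f B →
      IsScalingLimitOfRegular B Bh f → IsOctRegularOn f B := fun f hf =>
    isOctRegularOn_of_isScalingLimitOfRegular hB_open hBh hconv.converges
      (hf.of_le (by norm_num))
  exact ⟨fun f hf => ⟨isScalingLimitOfRegular_of_isOctRegularOn hB_open hB_bdd hB_bdry hBh
    hconv.converges.closure_right (hf.of_le (by norm_num)), hback f (hf.mono subset_closure)⟩,
    hback⟩
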